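/- **Theorem (inaccessible average max-entropy from one-way functions).** All logarithms are to base two, $[n]=\{1,\dots,n\}$, and a function $\varepsilon:\mathbb N\to[0,1]$ is negligible if $\varepsilon(n)=n^{-\omega(1)}$. PPT means probabilistic polynomial time. Let $f=\{f_n:\{0,1\}^n\to\{0,1\}^n\}_{n\in\mathbb N}$ be a one-way function: $f$ is computable in deterministic polynomial time, and for every PPT algorithm $B$ the probability $\Pr[f(B(f(X)))=f(X)]$, with $X$ uniform on $\{0,1\}^n$, is negligible in $n$. Let $\mathcal G=\{\mathcal G_n\}$ be a three-wise independent, constructible family of hash functions $g:\{0,1\}^n\to\{0,1\}^n$, each given by a bit string describing it. Three-wise independent means that for all distinct $x_1,x_2,x_3\in\{0,1\}^n$ and uniformly random $g\in\mathcal G_n$ the values $g(x_1),g(x_2),g(x_3)$ are independent and each is uniform on $\{0,1\}^n$. Constructible means that * given the description of $g\in\mathcal G_n$ and $x\in\{0,1\}^n$, the value $g(x)$ can be computed in deterministic time $\mathrm{poly}(n)$, and * there is a PPT algorithm that, given distinct $x_1,x_2\in\{0,1\}^n$ and $y_1,y_2\in\{0,1\}^n$, outputs (the description of) a uniformly random $g\in\mathcal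 G_n$ subject to $g(x_1)=y_1$ and $g(x_2)=y_2$, if there is such a $g$. Define $F$ on $\mathcal D_n=\{0,1\}^n\times\mathcal G_n\times[n]$ by $$F(x,g,i)=\bigl(g(f(x))_{1\dots i},\,g,\,i\bigr),$$ where $w_{1\dots i}$ denotes the first $i$ bits of $w$, and let $Z$ be uniform on $\mathcal D_n$. Then for every constant $d>0$, $F^{-1}$ has accessible average max-entropy at most $$k(n)=H(Z\mid F(Z))-\frac{d\log n}{n},$$ where $H(\cdot\mid\cdot)$ is conditional Shannon entropy. That is: for every PPT algorithm $A$ such that $A(z;r)\in F^{-1}(F(z))$ for every $z\in\mathcal D_n$ and all coin tosses $r$, there are sets $L(z)\subseteq\mathcal D_n$ with $z\in L(z)$ for all $z\in\mathcal D_n$, and a negligible function $\varepsilon$, such that for all sufficiently large $n$ $$\mathrm E\bigl[\log|L(Z)|\bigr]\le k(n)\qquad\text{and}\qquad \Pr\bigl[A(Z;R)\in L(Z)\bigr]\ge 1-\varepsilon(n),$$ where $R$ denotes uniformly random coin tosses of $A$. -/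

import Mathlib

open Filter
open scoped BigOperators ENNReal

noncomputable section

namespace InaccessibleEntropy

/-! ### Machine model: randomized programs over binary stacks, with a step count -/

/-- Programs acting on finitely many registers, each holding a stack of bits (the registers are
numbered, and a program mentions finitely many of them). This is a multi-stack machine with
structured control; up to polynomial overhead it is a probabilistic multi-tape Turing machine. -/
inductive Prog : Type
  /-- do nothing -/
  | skip : Prog
  /-- push the bit `b` on stack `r` -/
  | push (r : ℕ) (b : Bool) : Prog
  /-- remove the top bit of stack `r`, if there is one -/
  | pop (r : ℕ) : Prog
  /-- toss a fair coin and push the outcome on stack `r` -/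
  | flip (r : ℕ) : Prog
  /-- run `p`, then `q` -/
  | seq (p q : Prog) : Prog
  /-- run `p` if stack `r` is empty, `q` if its top bit is `false`, `t` if its top bit is `true` -/
  | branch (r : ℕ) (p q t : Prog) : Prog
  /-- run `p` repeatedly as long as stack `r` is not empty -/
  | loop (r : ℕ) (p : Prog) : Prog

/-- A program that tosses no coins. -/
def Prog.Deterministic : Prog → Prop
  | .skip => True
  | .push _ _ => True
  | .pop _ => True
  | .flip _ => False
  | .seq p q => p.Deterministic ∧ q.Deterministic
  | .branch _ p q t => p.Deterministic ∧ q.Deterministic ∧ t.Deterministic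
  | .loop _ p => p.Deterministic

/-- Contents of the registers. -/
abbrev Store : Type := ℕ → List Bool

/-- A configuration: the list of programs that remain to be executed, and the registers. -/
abbrev Config : Type := List Prog × Store

/-- One computation step. Each step inspects and changes at most one bit of one stack. A
configuration with nothing left to execute is halted, and stays as it is. -/
def step : Config → PMF Config
  | ([], s) => PMF.pure ([], s)
  | (.skip :: K, s) => PMF.pure (K, s)
  | (.push r b :: K, s) => PMF.pure (K, Function.update s r (b :: s r))
  | (.pop r :: K, s) => PMF.pure (K, Function.update s r (s r).tail)
  | (.flip r :: K, s) =>
      (PMF.uniformOfFintype Bool).map fun b => (K, Function.update s r (b :: s r))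
  | (.seq p q :: K, s) => PMF.pure (p :: q :: K, s)
  | (.branch r p q t :: K, s) =>
      match s r with
      | [] => PMF.pure (p :: K, s)
      | false :: _ => PMF.pure (q :: K, s)
      | true :: _ => PMF.pure (t :: K, s)
  | (.loop r p :: K, s) =>
      match s r with
      | [] => PMF.pure (K, s)
      | _ :: _ => PMF.pure (p :: .loop r p :: K, s)

/-- The distribution of the configuration after `T` steps from a given configuration. -/
def stepN : ℕ → Config → PMF Config
  | 0, c => PMF.pure c
  | T + 1, c => (step c).bind (stepN T)

/-- Registers `0, 1, …` hold the given input strings, all other registers are empty. -/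
def initStore (xs : List (List Bool)) : Store := fun r => xs.getD r []

/-- The distribution of the configuration of `p` after `T` steps on input `xs`. -/
def Prog.run (p : Prog) (xs : List (List Bool)) (T : ℕ) : PMF Config :=
  stepN T ([p], initStore xs)

/-- The registers `0, 1, …, ys.length - 1` hold the strings `ys`. -/
def Holds (s : Store) (ys : List (List Bool)) : Prop :=
  ∀ j (h : j < ys.length), s j = ys[j]

/-- For all coin tosses, `p` halts on input `xs` after at most `T` steps. -/
def Prog.HaltsWithin (p : Prog) (xs : List (List Bool)) (T : ℕ) : Prop :=
  ∀ c ∈ (p.run xs T).support, c.1 = []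

/-- For all coin tosses, if `p` halts on input `xs`, its final store satisfies `E`. -/
def Prog.AlwaysOutputs (p : Prog) (xs : List (List Bool)) (E : Store → Prop) : Prop :=
  ∀ T, ∀ c ∈ (p.run xs T).support, c.1 = [] → E c.2

/-- The probability, over the coin tosses of `p`, that `p` halts on input `xs` with a final store
satisfying `E`. -/
def Prog.outProb (p : Prog) (xs : List (List Bool)) (E : Store → Prop) : ℝ :=
  (⨆ T, (p.run xs T).toOuterMeasure {c | c.1 = [] ∧ E c.2} : ℝ≥0∞).toReal

/-- `p` runs in time polynomial in `n` on the inputs from the sets `I n`, where `enc` represents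
an input by a list of strings. -/
def Prog.PolyTimeOn (p : Prog) {I : ℕ → Type} (enc : ∀ n, I n → List (List Bool)) : Prop :=
  ∃ q : Polynomial ℕ, ∀ n (z : I n), p.HaltsWithin (enc n z) (q.eval n)

/-! ### Finite probability and entropy -/

/-- Probability of an event under the uniform distribution on a finite type. -/
def prob {Ω : Type} [Fintype Ω] (E : Ω → Prop) : ℝ :=
  open Classical in (Finset.univ.filter E).card / Fintype.card Ω

/-- Conditional probability `Pr[A | B]` under the uniform distribution on a finite type. -/
def condProb {Ω : Type} [Fintype Ω] (A B : Ω → Prop) : ℝ :=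
  prob (fun ω => A ω ∧ B ω) / prob B

/-- Conditional Shannon entropy `H(X | Y)`, in bits, of random variables on a finite type with the
uniform distribution: the expectation of `log (1 / Pr[X = x | Y = y])` over `(x, y) ← (X, Y)`. -/
def condEntropy {Ω α β : Type} [Fintype Ω] (X : Ω → α) (Y : Ω → β) : ℝ :=
  𝔼 ω : Ω, Real.logb 2 (1 / condProb (fun ω' => X ω' = X ω) (fun ω' => Y ω' = Y ω))

/-- Negligible functions `ℕ → [0, 1]`: smaller than every inverse polynomial. -/
def Negligible (μ : ℕ → ℝ) : Prop :=
  (∀ n, μ n ∈ Set.Icc (0 : ℝ) 1) ∧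
    Asymptotics.SuperpolynomialDecay atTop (fun n : ℕ => (n : ℝ)) μ

/-! ### One-way functions -/

/-- `{0,1}^n` -/
abbrev BitStr (n : ℕ) : Type := Fin n → Bool

/-- `f`, with `f n : {0,1}^n → {0,1}^n` for every `n`, is a one-way function. -/
structure IsOneWay (f : ∀ n, BitStr n → BitStr n) : Prop where
  /-- `f` is computable in deterministic polynomial time -/
  computable : ∃ p : Prog, p.Deterministic ∧
    p.PolyTimeOn (fun n (x : BitStr n) => [List.ofFn x]) ∧
    ∀ n (x : BitStr n), p.AlwaysOutputs [List.ofFn x] (fun s => Holds s [List.ofFn (f n x)])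
  /-- every probabilistic polynomial-time algorithm that is given `f(x)`, for a random `x`, finds
  a preimage of `f(x)` with at most negligible probability -/
  hard : ∀ p : Prog, p.PolyTimeOn (fun n (y : BitStr n) => [List.ofFn y]) →
    Negligible fun n => 𝔼 x : BitStr n, p.outProb [List.ofFn (f n x)]
      (fun s => ∃ x' : BitStr n, f n x' = f n x ∧ Holds s [List.ofFn x'])

/-! ### Hash families -/

/-- For every `n`, a finite nonempty family of functions `{0,1}^n → {0,1}^n`, each given by its
description, a bit string. -/
structure HashFamily where
  /-- the set of descriptions -/
  keys : ℕ → Finset (List Bool)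
  keys_nonempty : ∀ n, (keys n).Nonempty
  /-- the function with a given description -/
  eval : ∀ n, keys n → BitStr n → BitStr n

/-- `t`-wise independence: for distinct `x_1, …, x_t` and random `g` in the family, the values
`g(x_1), …, g(x_t)` are independent, and each is uniform on `{0,1}^n`. -/
def HashFamily.WiseIndependent (G : HashFamily) (t : ℕ) : Prop :=
  ∀ n (x : Fin t → BitStr n), Function.Injective x →
    (∀ j (y : BitStr n), prob (fun g : G.keys n => G.eval n g (x j) = y) = 1 / 2 ^ n) ∧
    ∀ y : Fin t → BitStr n, prob (fun g : G.keys n => ∀ j, G.eval n g (x j) = y j) =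
      ∏ j, prob (fun g : G.keys n => G.eval n g (x j) = y j)

/-- The family is explicit: from the description of `g` and from `x`, the value `g(x)` can be
computed in deterministic time polynomial in `n`. -/
def HashFamily.Explicit (G : HashFamily) : Prop :=
  ∃ p : Prog, p.Deterministic ∧
    p.PolyTimeOn (fun n (z : G.keys n × BitStr n) => [z.1.1, List.ofFn z.2]) ∧
    ∀ n (g : G.keys n) (x : BitStr n),
      p.AlwaysOutputs [g.1, List.ofFn x] (fun s => Holds s [List.ofFn (G.eval n g x)])

/-- Two distinct points of `{0,1}^n`, with a prescribed value at each. -/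
structure TwoPoint (n : ℕ) where
  /-- first point -/
  x₁ : BitStr n
  /-- value at the first point -/
  y₁ : BitStr n
  /-- second point -/
  x₂ : BitStr n
  /-- value at the second point -/
  y₂ : BitStr n
  ne : x₁ ≠ x₂

/-- The two points and two values, as the input of a program. -/
def TwoPoint.enc {n : ℕ} (c : TwoPoint n) : List (List Bool) :=
  [List.ofFn c.x₁, List.ofFn c.y₁, List.ofFn c.x₂, List.ofFn c.y₂]

/-- `g` takes the prescribed values. -/
def HashFamily.Fits (G : HashFamily) {n : ℕ} (c : TwoPoint n) (g : G.keys n) : Prop :=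
  G.eval n g c.x₁ = c.y₁ ∧ G.eval n g c.x₂ = c.y₂

/-- The family is constructible: it is explicit, and there is a probabilistic polynomial-time
algorithm that, given distinct points `x₁`, `x₂` and values `y₁`, `y₂`, outputs a uniformly random
`g` in the family among those with `g(x₁) = y₁` and `g(x₂) = y₂` (if there are any). -/
def HashFamily.Constructible (G : HashFamily) : Prop :=
  G.Explicit ∧ ∃ p : Prog,
    p.PolyTimeOn (fun n (c : TwoPoint n) => c.enc) ∧
    ∀ n (c : TwoPoint n) (g : G.keys n), G.Fits c g →
      p.outProb c.enc (fun s => Holds s [g.1]) = 1 / (Nat.card {g' : G.keys n // G.Fits c g'} : ℝ)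

/-! ### Accessible average max-entropy -/

section Accessible

variable {D R : ℕ → Type} (F : ∀ n, D n → R n) (enc : ∀ n, D n → List (List Bool))

/-- `A` is an `F`-collision-finder: on every input `z` and for all coin tosses, `A` outputs an
element of `F⁻¹(F(z))`. -/
def IsCollisionFinder (A : Prog) : Prop :=
  ∀ n (z : D n), A.AlwaysOutputs (enc n z) (fun s => ∃ z', F n z' = F n z ∧ Holds s (enc n z'))

/-- `F⁻¹` has accessible average max-entropy at most `k`, where `k` may depend on the security
parameter `n`, and the domain `D n` of `F` has the uniform distribution. -/
def AccAvgMaxEntropyAtMost [∀ n, Fintype (D n)] (k : ℕ → ℝ) : Prop :=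
  ∀ A : Prog, A.PolyTimeOn enc → IsCollisionFinder F enc A →
    ∃ (L : ∀ n, D n → Finset (D n)) (ε : ℕ → ℝ), Negligible ε ∧
      (∀ n z, z ∈ L n z) ∧
      ∀ᶠ n in atTop,
        𝔼 z : D n, Real.logb 2 ((L n z).card : ℝ) ≤ k n ∧
        1 - ε n ≤ 𝔼 z : D n, A.outProb (enc n z) (fun s => ∃ z' ∈ L n z, Holds s (enc n z'))

end Accessible

/-! ### The function `F(x, g, i) = (g(f(x))_{1…i}, g, i)` -/

/-- The domain `{0,1}^n × 𝒢 × [n]`, where `[n] = {1, …, n}`. -/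
abbrev HashDom (G : HashFamily) (n : ℕ) : Type :=
  BitStr n × G.keys n × Finset.Icc 1 n

/-- `(x, g, i)` as input or output of a program: `x`, the description of `g`, and `i` in unary. -/
def HashDom.enc (G : HashFamily) (n : ℕ) (z : HashDom G n) : List (List Bool) :=
  [List.ofFn z.1, z.2.1.1, List.replicate z.2.2.1 true]

/-- `F(x, g, i) = (g(f(x))_{1…i}, g, i)` -/
def hashPrefix (f : ∀ n, BitStr n → BitStr n) (G : HashFamily) (n : ℕ) (z : HashDom G n) :
    List Bool × G.keys n × Finset.Icc 1 n :=
  ((List.ofFn (G.eval n z.2.1 (f n z.1))).take z.2.2.1, z.2.1, z.2.2)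

end InaccessibleEntropy

end

noncomputable section

namespace InaccessibleEntropy

/-! ### Running programs: halting time and distribution of the final store -/

/-! Fix a collision finder A and a constant c ≥ 8d + 7. Call an image y of f with m preimages heavy
at prefix length i if m/2^n ≥ 2^(-i) n^(-c). For z = (x, g, i), the set L(z) (`goodSet`) omits from
F⁻¹(F(z)) those (x', g, i) whose image f(x') differs from f(x) and is heavy. Two things are needed:
A rarely outputs an omitted element, and the omission lowers the average log-size enough.

For the first, the inverter, given y, samples x, i and a hash function g conditioned on g(f(x)) and
g(y) agreeing in the first i bits, and runs A on (x, g, i). If f(x) ≠ y, this agreement has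
probability 2^(-i), so (x, g, i) appears with about 2^i times its density under Z. Since y = f(X)
has weight m/2^n, a hit on a heavy y costs at most a factor n^c in the passage to the inverter.
Hence A leaves L(Z) with probability at most 2 n^c ν, where ν is the inversion probability
(`inverter_outProb`, `one_sub_outProb_le`, `expect_one_sub_outProb_le`). The factor 2 pays for
sampling i with fair coins in bounded time.

For the second, omitting a fraction p of a set lowers the logarithm of its size by at least p.
Exchanging z and z' within a fiber of F turns the average omitted fraction into an average over
those z whose own image is heavy, of the fraction of colliding x' with another image
(`expect_logb_card_le`). If moreover m 2^i ≤ 2^n/64 and at least a quarter of all points have fibers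
no larger than that of x, then three-wise independence and a second-moment bound make this fraction
at least 1/4 on average over g (`quarter_le_sum_ratio`). About c log n lengths i lie between the two
thresholds (`le_card_window`). At least half of the x qualify: the rank condition fails for at most
a quarter (`card_small_rank`), and too large fibers occur for at most a quarter when n is large,
because otherwise a random guess would invert f (`card_heavy_le`). The resulting gap, (c log n -
O(1))/(8n), is at least d log n / n (`entropy_gap`, `le_log_sub_div`).

The remaining work realizes the inverter as a program, with a time bound for all coin tosses and a
lower bound on its success probability. -/

theorem bind_congr_support {α β : Type} {p : PMF α} {f g : α → PMF β}
    (h : ∀ a ∈ p.support, f a = g a) : p.bind f = p.bind g := by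
  ext b
  rw [PMF.bind_apply, PMF.bind_apply]
  refine tsum_congr fun a => ?_
  by_cases ha : a ∈ p.support
  · rw [h a ha]
  · rw [(PMF.apply_eq_zero_iff p a).2 ha, zero_mul, zero_mul]

/-- Within `T` steps, for all coin tosses, the computation from `c` arrives at the list `K` of
programs; `μ` is the distribution of the store at that moment. -/
inductive Reach (K : List Prog) : ℕ → Config → PMF Store → Prop
  | done (T : ℕ) (s : Store) : Reach K T (K, s) (PMF.pure s)
  | next {T : ℕ} {c : Config} {ι : Type} (π : PMF ι) (h : ι → Config) (ν : ι → PMF Store)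
      (hc : step c = π.map h) (hr : ∀ j ∈ π.support, Reach K T (h j) (ν j)) :
      Reach K (T + 1) c (π.bind ν)

theorem Reach.mono {K : List Prog} {T T' : ℕ} {c : Config} {μ : PMF Store} (h : Reach K T c μ)
    (hT : T ≤ T') : Reach K T' c μ := by
  induction h generalizing T' with
  | done T s => exact .done _ _
  | next π h ν hc _ ih =>
    obtain ⟨T', rfl⟩ : ∃ t, T' = t + 1 := ⟨T' - 1, by omega⟩
    exact .next π h ν hc fun j hj => ih j hj (by omega)

theorem Reach.trans {K K' : List Prog} {T T' : ℕ} {c : Config} {μ : PMF Store}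
    {ν : Store → PMF Store} (h : Reach K' T c μ)
    (h' : ∀ s ∈ μ.support, Reach K T' (K', s) (ν s)) : Reach K (T + T') c (μ.bind ν) := by
  induction h with
  | done T s =>
    rw [PMF.pure_bind]
    exact (h' s (by simp)).mono (by omega)
  | @next T c ι π h κ hc hr ih =>
    rw [PMF.bind_bind, show T + 1 + T' = (T + T') + 1 by omega]
    refine .next π h _ hc fun j hj => ih j hj fun s hs => h' s ?_
    rw [PMF.mem_support_bind_iff]
    exact ⟨j, hj, hs⟩

theorem Reach.of_pure {K : List Prog} {T : ℕ} {c c' : Config} {μ : PMF Store}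
    (hc : step c = PMF.pure c') (h : Reach K T c' μ) : Reach K (T + 1) c μ := by
  have := Reach.next (K := K) (T := T) (c := c) (PMF.pure c') id (fun _ => μ)
    (by rw [PMF.map_id, hc]) (fun j hj => by
      rw [PMF.mem_support_pure_iff] at hj; subst hj; exact h)
  rwa [PMF.pure_bind] at this

theorem stepN_nil (T : ℕ) (s : Store) : stepN T ([], s) = PMF.pure ([], s) := by
  induction T with
  | zero => rfl
  | succ T ih => rw [stepN, step, PMF.pure_bind, ih]

/-- Arriving at the empty list means halting, and halted configurations are stationary, so runs that
finish early do not disturb the distribution after exactly `T` steps. -/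
theorem Reach.stepN_eq {T : ℕ} {c : Config} {μ : PMF Store} (h : Reach [] T c μ) :
    stepN T c = μ.map fun s => ([], s) := by
  induction h with
  | done T s => rw [stepN_nil, PMF.pure_map]
  | next π h ν hc _ ih =>
    rw [stepN, hc, PMF.bind_map, PMF.map_bind]
    exact bind_congr_support fun j hj => ih j hj

/-- For all coin tosses, `p` halts from store `s` within `T` steps, and the final store has
distribution `μ`. -/
def Runs (p : Prog) (s : Store) (T : ℕ) (μ : PMF Store) : Prop :=
  ∀ K, Reach K T (p :: K, s) μ

theorem Runs.mono {p : Prog} {s : Store} {T T' : ℕ} {μ : PMF Store} (h : Runs p s T μ)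
    (hT : T ≤ T') : Runs p s T' μ := fun K => (h K).mono hT

theorem Runs.skip (s : Store) : Runs .skip s 1 (PMF.pure s) := fun K =>
  .of_pure (c' := (K, s)) rfl (.done 0 s)

theorem Runs.push (r : ℕ) (b : Bool) (s : Store) :
    Runs (.push r b) s 1 (PMF.pure (Function.update s r (b :: s r))) := fun K =>
  .of_pure (c' := (K, _)) rfl (.done 0 _)

theorem Runs.pop (r : ℕ) (s : Store) :
    Runs (.pop r) s 1 (PMF.pure (Function.update s r (s r).tail)) := fun K =>
  .of_pure (c' := (K, _)) rfl (.done 0 _)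

theorem Runs.flip (r : ℕ) (s : Store) :
    Runs (.flip r) s 1
      ((PMF.uniformOfFintype Bool).map fun b => Function.update s r (b :: s r)) := fun K =>
  .next (PMF.uniformOfFintype Bool) (fun b => (K, Function.update s r (b :: s r)))
    (fun b => PMF.pure (Function.update s r (b :: s r))) rfl fun _ _ => .done 0 _

theorem Runs.seq {p q : Prog} {s : Store} {T T' : ℕ} {μ : PMF Store} {ν : Store → PMF Store}
    (h : Runs p s T μ) (h' : ∀ s' ∈ μ.support, Runs q s' T' (ν s')) :
    Runs (.seq p q) s (T + T' + 1) (μ.bind ν) := fun K =>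
  .of_pure (c' := (p :: q :: K, s)) rfl ((h (q :: K)).trans fun s' hs' => h' s' hs' K)

theorem Runs.branch_nil {r : ℕ} {p q t : Prog} {s : Store} {T : ℕ} {μ : PMF Store}
    (hs : s r = []) (h : Runs p s T μ) : Runs (.branch r p q t) s (T + 1) μ := fun K =>
  .of_pure (c' := (p :: K, s)) (by simp [step, hs]) (h K)

theorem Runs.branch_false {r : ℕ} {p q t : Prog} {s : Store} {T : ℕ} {μ : PMF Store}
    {l : List Bool} (hs : s r = false :: l) (h : Runs q s T μ) :
    Runs (.branch r p q t) s (T + 1) μ := fun K =>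
  .of_pure (c' := (q :: K, s)) (by simp [step, hs]) (h K)

theorem Runs.branch_true {r : ℕ} {p q t : Prog} {s : Store} {T : ℕ} {μ : PMF Store}
    {l : List Bool} (hs : s r = true :: l) (h : Runs t s T μ) :
    Runs (.branch r p q t) s (T + 1) μ := fun K =>
  .of_pure (c' := (t :: K, s)) (by simp [step, hs]) (h K)

theorem Runs.loop_nil {r : ℕ} {p : Prog} {s : Store} (hs : s r = []) :
    Runs (.loop r p) s 1 (PMF.pure s) := fun K =>
  .of_pure (c' := (K, s)) (by simp [step, hs]) (.done 0 s)

theorem Runs.loop_cons {r : ℕ} {p : Prog} {s : Store} {T T' : ℕ} {μ : PMF Store}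
    {ν : Store → PMF Store} (hs : s r ≠ []) (h : Runs p s T μ)
    (h' : ∀ s' ∈ μ.support, Runs (.loop r p) s' T' (ν s')) :
    Runs (.loop r p) s (T + T' + 1) (μ.bind ν) := fun K => by
  obtain ⟨b, l, hb⟩ := List.exists_cons_of_ne_nil hs
  exact .of_pure (c' := (p :: .loop r p :: K, s)) (by simp [step, hb])
    ((h (.loop r p :: K)).trans fun s' hs' => h' s' hs' K)

/-- After the larger of the two times every run has halted, so both distributions are read off the
same distribution of configurations. -/
theorem Runs.unique {p : Prog} {s : Store} {T T' : ℕ} {μ μ' : PMF Store} (h : Runs p s T μ)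
    (h' : Runs p s T' μ') : μ = μ' := by
  have h1 := ((h.mono (le_max_left T T')) []).stepN_eq
  have h2 := ((h'.mono (le_max_right T T')) []).stepN_eq
  have h3 := congrArg (PMF.map Prod.snd) (h1.symm.trans h2)
  simpa [PMF.map_comp, Function.comp_def, PMF.map, PMF.bind_pure] using h3

/-! ### Straight-line programs -/

/-- Programs without loops and coin tosses. -/
def Prog.Straight : Prog → Prop
  | .skip => True
  | .push _ _ => True
  | .pop _ => True
  | .flip _ => False
  | .seq p q => p.Straight ∧ q.Straight
  | .branch _ p q t => p.Straight ∧ q.Straight ∧ t.Straight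
  | .loop _ _ => False

/-- The effect of a program without loops and coin tosses. -/
def Prog.exec : Prog → Store → Store
  | .skip, s => s
  | .push r b, s => Function.update s r (b :: s r)
  | .pop r, s => Function.update s r (s r).tail
  | .flip _, s => s
  | .seq p q, s => q.exec (p.exec s)
  | .branch r p q t, s =>
    match s r with
    | [] => p.exec s
    | false :: _ => q.exec s
    | true :: _ => t.exec s
  | .loop _ _, s => s

/-- A bound on the number of steps of a program without loops. -/
def Prog.cost : Prog → ℕ
  | .seq p q => p.cost + q.cost + 1
  | .branch _ p q t => p.cost + q.cost + t.cost + 1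
  | _ => 1

theorem Prog.Straight.runs {p : Prog} (hp : p.Straight) (s : Store) :
    Runs p s p.cost (PMF.pure (p.exec s)) := by
  induction p generalizing s with
  | skip => exact .skip s
  | push r b => exact .push r b s
  | pop r => exact .pop r s
  | flip r => exact hp.elim
  | seq p q ihp ihq =>
    have := (ihp hp.1 s).seq (T' := q.cost) (ν := fun s' => PMF.pure (q.exec s'))
      fun s' _ => ihq hp.2 s'
    rwa [PMF.pure_bind] at this
  | branch r p q t ihp ihq iht =>
    simp only [Prog.cost, Prog.exec]
    rcases h : s r with _ | ⟨_ | _, l⟩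
    · exact (Runs.branch_nil h (ihp hp.1 s)).mono (by omega)
    · exact (Runs.branch_false h (ihq hp.2.1 s)).mono (by omega)
    · exact (Runs.branch_true h (iht hp.2.2 s)).mono (by omega)
  | loop r p _ => exact hp.elim

theorem Runs.seq_pure {p q : Prog} {s s' : Store} {T T' : ℕ} {μ : PMF Store}
    (h : Runs p s T (PMF.pure s')) (h' : Runs q s' T' μ) :
    Runs (.seq p q) s (T + T' + 1) μ := by
  have := h.seq (ν := fun _ => μ) (T' := T') fun s'' hs'' => by
    rw [PMF.mem_support_pure_iff] at hs''; subst hs''; exact h'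
  rwa [PMF.pure_bind] at this

/-- Lets the second program's result depend on an abstract state instead of the store. Since `h`
need not be injective, a result is chosen for each store; `Runs.unique` shows that it agrees with `μ
j` for every state `j` behind that store. -/
theorem Runs.seq_map {p q : Prog} {s : Store} {T T' : ℕ} {ι : Type} {π : PMF ι} {h : ι → Store}
    {μ : ι → PMF Store} (hp : Runs p s T (π.map h)) (hq : ∀ j ∈ π.support, Runs q (h j) T' (μ j)) :
    Runs (.seq p q) s (T + T' + 1) (π.bind μ) := by
  classical
  have hex : ∀ s' ∈ (π.map h).support, ∃ ν, Runs q s' T' ν := fun s' hs' => by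
    obtain ⟨j, hj, rfl⟩ := (PMF.mem_support_map_iff _ _ _).1 hs'
    exact ⟨_, hq j hj⟩
  have := hp.seq (T' := T') (ν := fun s' => if hs : ∃ ν, Runs q s' T' ν then hs.choose else
    PMF.pure s') fun s' hs' => by
      rw [dif_pos (hex s' hs')]
      exact (hex s' hs').choose_spec
  rw [PMF.bind_map] at this
  convert this using 1
  refine bind_congr_support fun j hj => ?_
  have hj' := hex (h j) ((PMF.mem_support_map_iff _ _ _).2 ⟨j, hj, rfl⟩)
  simp only [Function.comp]
  rw [dif_pos hj']
  exact (hq j hj).unique hj'.choose_spec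

/-- A loop over a counter: `st k a` is the store in state `a` when `k` rounds remain, and `π` gives
the distribution of the next state. -/
theorem Runs.loop_counter {α : Type} {r : ℕ} {p : Prog} {T : ℕ} (st : ℕ → α → Store)
    (π : α → PMF α) (hlen : ∀ k a, (st k a r).length = k)
    (hbody : ∀ k a, Runs p (st (k + 1) a) T ((π a).map (st k)))
    (iter : ℕ → α → PMF α) (h0 : ∀ a, iter 0 a = PMF.pure a)
    (hs : ∀ k a, iter (k + 1) a = (π a).bind (iter k)) (k : ℕ) (a : α) :
    Runs (.loop r p) (st k a) (k * (T + 1) + 1) ((iter k a).map (st 0)) := by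
  induction k generalizing a with
  | zero =>
    rw [h0, PMF.pure_map]
    exact (Runs.loop_nil (List.eq_nil_of_length_eq_zero (hlen 0 a))).mono (by omega)
  | succ k ih =>
    have hne : st (k + 1) a r ≠ [] := by
      intro h; have := hlen (k + 1) a; simp [h] at this
    rw [hs, PMF.map_bind]
    have h1 : Runs (.seq p (.loop r p)) (st (k + 1) a) (T + (k * (T + 1) + 1) + 1)
        ((π a).bind fun a => (iter k a).map (st 0)) :=
      (hbody k a).seq_map fun j _ => ih j
    intro K
    obtain ⟨b, l, hb⟩ := List.exists_cons_of_ne_nil hne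
    have h2 : step (.seq p (.loop r p) :: K, st (k + 1) a)
        = PMF.pure (p :: .loop r p :: K, st (k + 1) a) := rfl
    -- A loop with nonempty counter makes the same first step as `p` followed by the loop. So the
    -- run obtained from `seq_map` becomes a run of the loop once its first step is exchanged.
    have h3 : step (.loop r p :: K, st (k + 1) a) = step (.seq p (.loop r p) :: K, st (k + 1) a) := by
      simp [step, hb]
    have h4 := h1 K
    rw [show (k + 1) * (T + 1) + 1 = T + (k * (T + 1) + 1) + 1 by ring]
    generalize hμ : ((π a).bind fun a => (iter k a).map (st 0)) = μ at h4
    generalize hc : (Prog.seq p (.loop r p) :: K, st (k + 1) a) = c at h4 h3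
    cases h4 with
    | done T s =>
      exfalso
      have := congrArg (fun c => c.1.length) hc
      simp at this
    | next π h ν hc hr => exact .next π h ν (h3.trans hc) hr

/-! ### Renaming of registers -/

/-- The program with its registers renamed. -/
def Prog.rename (φ : ℕ → ℕ) : Prog → Prog
  | .skip => .skip
  | .push r b => .push (φ r) b
  | .pop r => .pop (φ r)
  | .flip r => .flip (φ r)
  | .seq p q => .seq (p.rename φ) (q.rename φ)
  | .branch r p q t => .branch (φ r) (p.rename φ) (q.rename φ) (t.rename φ)
  | .loop r p => .loop (φ r) (p.rename φ)

theorem update_extend {φ : ℕ → ℕ} (hφ : φ.Injective) (t s : Store) (r : ℕ) (l : List Bool) :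
    Function.update (Function.extend φ t s) (φ r) l
      = Function.extend φ (Function.update t r l) s := by
  funext r'
  by_cases h : ∃ a, φ a = r'
  · obtain ⟨a, rfl⟩ := h
    rw [hφ.extend_apply]
    by_cases ha : a = r
    · subst ha; simp
    · rw [Function.update_of_ne (fun h => ha (hφ h)), Function.update_of_ne ha, hφ.extend_apply]
  · rw [Function.update_of_ne (fun h' => h ⟨r, h'.symm⟩), Function.extend_apply' _ _ _ h,
      Function.extend_apply' _ _ _ h]

/-- `Function.extend φ t s` shows `t` through the renamed registers and `s` in all others. A renamed
program sees and changes only `t`, so a step commutes with this embedding, and the context `K`, `s`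
is carried along. -/
theorem step_rename {φ : ℕ → ℕ} (hφ : φ.Injective) (K : List Prog) (s : Store) (p : Prog)
    (J : List Prog) (t : Store) :
    step (((p :: J).map (Prog.rename φ)) ++ K, Function.extend φ t s)
      = (step (p :: J, t)).map
          fun c => (c.1.map (Prog.rename φ) ++ K, Function.extend φ c.2 s) := by
  cases p with
  | skip => simp [step, Prog.rename, PMF.pure_map]
  | push r b => simp [step, Prog.rename, PMF.pure_map, hφ.extend_apply, update_extend hφ]
  | pop r => simp [step, Prog.rename, PMF.pure_map, hφ.extend_apply, update_extend hφ]
  | flip r =>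
    simp [step, Prog.rename, PMF.map_comp, Function.comp_def, hφ.extend_apply, update_extend hφ]
  | seq p q => simp [step, Prog.rename, PMF.pure_map]
  | branch r p q u =>
    rcases h : t r with _ | ⟨_ | _, l⟩ <;>
      simp [step, Prog.rename, PMF.pure_map, hφ.extend_apply, h]
  | loop r p =>
    rcases h : t r with _ | ⟨b, l⟩ <;>
      simp [step, Prog.rename, PMF.pure_map, hφ.extend_apply, h]

theorem reach_rename {φ : ℕ → ℕ} (hφ : φ.Injective) (K : List Prog) (s : Store) (T : ℕ)
    (J : List Prog) (t : Store) (h : ∀ c ∈ (stepN T (J, t)).support, c.1 = []) :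
    Reach K T (J.map (Prog.rename φ) ++ K, Function.extend φ t s)
      ((stepN T (J, t)).map fun c => Function.extend φ c.2 s) := by
  induction T generalizing J t with
  | zero =>
    have : J = [] := h (J, t) (by simp [stepN])
    subst this
    simpa [stepN, PMF.pure_map] using Reach.done (K := K) 0 (Function.extend φ t s)
  | succ T ih =>
    cases J with
    | nil =>
      rw [stepN_nil, PMF.pure_map]
      exact .done _ _
    | cons p J =>
      rw [stepN, PMF.map_bind]
      refine .next _ _ _ (step_rename hφ K s p J t) fun c hc => ih c.1 c.2 fun c' hc' => h c' ?_
      rw [stepN, PMF.mem_support_bind_iff]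
      exact ⟨c, hc, hc'⟩

/-- A program that halts on `xs` also halts, with the same distribution of results, if its registers
are renamed and the store holds other things in the other registers. -/
theorem Prog.HaltsWithin.runs_rename {p : Prog} {xs : List (List Bool)} {T : ℕ}
    (h : p.HaltsWithin xs T) {φ : ℕ → ℕ} (hφ : φ.Injective) {s : Store}
    (hs : ∀ r, s (φ r) = initStore xs r) :
    Runs (p.rename φ) s T ((p.run xs T).map fun c => Function.extend φ c.2 s) := by
  intro K
  have hs' : Function.extend φ (initStore xs) s = s := by
    funext r
    by_cases hr : ∃ a, φ a = r
    · obtain ⟨a, rfl⟩ := hr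
      rw [hφ.extend_apply, hs]
    · rw [Function.extend_apply' _ _ _ hr]
  have := reach_rename hφ K s T [p] (initStore xs) h
  rw [hs'] at this
  simpa [Prog.run] using this

/-! ### Output probabilities -/

theorem stepN_succ' (T : ℕ) (c : Config) : stepN (T + 1) c = (stepN T c).bind step := by
  induction T generalizing c with
  | zero => simp [stepN, PMF.bind_pure, PMF.pure_bind]
  | succ T ih =>
    rw [stepN]
    conv_rhs => rw [stepN]
    rw [PMF.bind_bind]
    exact congrArg _ (funext fun c' => ih c')

/-- Halted configurations never move, so the supremum over `T` in `outProb` is attained at any time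
by which the program has halted. -/
theorem run_mono (p : Prog) (xs : List (List Bool)) (E : Store → Prop) :
    Monotone fun T => (p.run xs T).toOuterMeasure {c | c.1 = [] ∧ E c.2} := by
  classical
  refine monotone_nat_of_le_succ fun T => ?_
  rw [Prog.run, Prog.run, stepN_succ', PMF.toOuterMeasure_bind_apply, PMF.toOuterMeasure_apply]
  refine ENNReal.tsum_le_tsum fun c => ?_
  by_cases hc : c ∈ {c : Config | c.1 = [] ∧ E c.2}
  · rw [Set.indicator_of_mem hc]
    obtain ⟨J, s⟩ := c
    obtain ⟨hJ, hE⟩ := hc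
    simp only at hJ hE
    subst hJ
    have : (step ([], s)).toOuterMeasure {c | c.1 = [] ∧ E c.2} = 1 := by
      rw [step, PMF.toOuterMeasure_pure_apply, if_pos ⟨rfl, hE⟩]
    rw [this, mul_one]
  · rw [Set.indicator_of_notMem hc]
    exact zero_le

theorem Prog.HaltsWithin.stepN_add {p : Prog} {xs : List (List Bool)} {T : ℕ}
    (h : p.HaltsWithin xs T) (k : ℕ) : p.run xs (T + k) = p.run xs T := by
  induction k with
  | zero => rfl
  | succ k ih =>
    have : p.run xs (T + (k + 1)) = (p.run xs (T + k)).bind step := stepN_succ' _ _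
    rw [this, ih]
    conv_rhs => rw [← PMF.bind_pure (p.run xs T)]
    refine bind_congr_support fun c hc => ?_
    obtain ⟨J, s⟩ := c
    have hJ : J = [] := h _ hc
    subst hJ
    rfl

theorem Prog.HaltsWithin.iSup_eq {p : Prog} {xs : List (List Bool)} {T : ℕ}
    (h : p.HaltsWithin xs T) (E : Store → Prop) :
    (⨆ T, (p.run xs T).toOuterMeasure {c | c.1 = [] ∧ E c.2})
      = (p.run xs T).toOuterMeasure {c | E c.2} := by
  have h1 : (p.run xs T).toOuterMeasure {c | c.1 = [] ∧ E c.2}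
      = (p.run xs T).toOuterMeasure {c | E c.2} :=
    PMF.toOuterMeasure_apply_eq_of_inter_support_eq _ (by
      ext c
      exact ⟨fun hc => ⟨hc.1.2, hc.2⟩, fun hc => ⟨⟨h c hc.2, hc.1⟩, hc.2⟩⟩)
  rw [← h1]
  refine le_antisymm (iSup_le fun T' => ?_) (le_iSup (fun T => (p.run xs T).toOuterMeasure _) T)
  rw [← h.stepN_add T']
  exact run_mono p xs E (by omega)

theorem Prog.HaltsWithin.outProb_eq {p : Prog} {xs : List (List Bool)} {T : ℕ}
    (h : p.HaltsWithin xs T) (E : Store → Prop) :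
    p.outProb xs E = ((p.run xs T).toOuterMeasure {c | E c.2}).toReal := by
  rw [Prog.outProb, h.iSup_eq]

theorem toOuterMeasure_le_one {α : Type} (p : PMF α) (s : Set α) : p.toOuterMeasure s ≤ 1 := by
  rw [PMF.toOuterMeasure_apply, ← p.tsum_coe]
  exact ENNReal.tsum_le_tsum fun a => Set.indicator_le_self _ _ _

theorem toOuterMeasure_ne_top {α : Type} (p : PMF α) (s : Set α) : p.toOuterMeasure s ≠ ∞ :=
  ne_top_of_le_ne_top ENNReal.one_ne_top (toOuterMeasure_le_one p s)

theorem Runs.haltsWithin {p : Prog} {xs : List (List Bool)} {T : ℕ} {μ : PMF Store}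
    (h : Runs p (initStore xs) T μ) : p.HaltsWithin xs T := by
  intro c hc
  rw [Prog.run, (h []).stepN_eq] at hc
  obtain ⟨s, _, rfl⟩ := (PMF.mem_support_map_iff _ _ _).1 hc
  rfl

theorem Runs.outProb_eq {p : Prog} {xs : List (List Bool)} {T : ℕ} {μ : PMF Store}
    (h : Runs p (initStore xs) T μ) (E : Store → Prop) :
    p.outProb xs E = (μ.toOuterMeasure {s | E s}).toReal := by
  rw [h.haltsWithin.outProb_eq, Prog.run, (h []).stepN_eq, PMF.toOuterMeasure_map_apply]
  rfl

/-- For all coin tosses, `p` halts from store `s` within `T` steps, and the final store is in `E`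
with probability at least `a`. -/
def Wins (p : Prog) (s : Store) (T : ℕ) (E : Set Store) (a : ℝ≥0∞) : Prop :=
  ∃ μ, Runs p s T μ ∧ a ≤ μ.toOuterMeasure E

theorem Wins.mono {p : Prog} {s : Store} {T T' : ℕ} {E : Set Store} {a a' : ℝ≥0∞}
    (h : Wins p s T E a) (hT : T ≤ T') (ha : a' ≤ a) : Wins p s T' E a' :=
  let ⟨μ, h1, h2⟩ := h
  ⟨μ, h1.mono hT, ha.trans h2⟩

/-- The law of total probability for lower bounds. Only states in the support of `π` matter; the
default chosen elsewhere has weight zero. -/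
theorem Wins.seq {p q : Prog} {s : Store} {T T' : ℕ} {ι : Type} {π : PMF ι} {h : ι → Store}
    {E : Set Store} {a : ι → ℝ≥0∞} (hp : Runs p s T (π.map h))
    (hq : ∀ j ∈ π.support, Wins q (h j) T' E (a j)) :
    Wins (.seq p q) s (T + T' + 1) E (∑' j, π j * a j) := by
  classical
  let μ : ι → PMF Store := fun j => if hj : Wins q (h j) T' E (a j) then hj.choose else PMF.pure s
  refine ⟨π.bind μ, hp.seq_map fun j hj => ?_, ?_⟩
  · simp only [μ]
    rw [dif_pos (hq j hj)]
    exact (hq j hj).choose_spec.1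
  · rw [PMF.toOuterMeasure_bind_apply]
    refine ENNReal.tsum_le_tsum fun j => ?_
    by_cases hj : j ∈ π.support
    · refine mul_le_mul_right ?_ _
      simp only [μ]
      rw [dif_pos (hq j hj)]
      exact (hq j hj).choose_spec.2
    · rw [(PMF.apply_eq_zero_iff π j).2 hj, zero_mul, zero_mul]

theorem Wins.seq_const {p q : Prog} {s : Store} {T T' : ℕ} {ι : Type} {π : PMF ι} {h : ι → Store}
    {E : Set Store} {a : ℝ≥0∞} (hp : Runs p s T (π.map h))
    (hq : ∀ j ∈ π.support, Wins q (h j) T' E a) : Wins (.seq p q) s (T + T' + 1) E a := by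
  have := Wins.seq hp hq
  rwa [ENNReal.tsum_mul_right, PMF.tsum_coe, one_mul] at this

theorem Wins.seq_pure {p q : Prog} {s s' : Store} {T T' : ℕ} {E : Set Store} {a : ℝ≥0∞}
    (hp : Runs p s T (PMF.pure s')) (hq : Wins q s' T' E a) :
    Wins (.seq p q) s (T + T' + 1) E a :=
  let ⟨μ, h1, h2⟩ := hq
  ⟨μ, hp.seq_pure h1, h2⟩

theorem Runs.wins_pure {p : Prog} {s s' : Store} {T : ℕ} {E : Set Store}
    (h : Runs p s T (PMF.pure s')) (hE : s' ∈ E) : Wins p s T E 1 :=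
  ⟨_, h, by rw [PMF.toOuterMeasure_pure_apply, if_pos hE]⟩

/-! ### Uniform bit strings -/

theorem Runs.cast {p : Prog} {s : Store} {T T' : ℕ} {μ μ' : PMF Store}
    (h : Runs p s T μ) (hT : T ≤ T') (hμ : μ = μ') : Runs p s T' μ' :=
  hμ ▸ h.mono hT

theorem uniformOfFintype_bind_map_equiv {α β γ : Type} [Fintype α] [Nonempty α] [Fintype β]
    [Nonempty β] [Fintype γ] [Nonempty γ] (e : α × β ≃ γ) :
    (PMF.uniformOfFintype α).bind (fun a => (PMF.uniformOfFintype β).map fun b => e (a, b))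
      = PMF.uniformOfFintype γ := by
  classical
  ext c
  obtain ⟨⟨a, b⟩, rfl⟩ := e.surjective c
  rw [PMF.bind_apply, tsum_fintype, Finset.sum_eq_single a]
  · rw [PMF.map_apply, tsum_fintype, Finset.sum_eq_single b]
    · simp only [if_true, PMF.uniformOfFintype_apply]
      rw [← Fintype.card_congr e, Fintype.card_prod, Nat.cast_mul, ENNReal.mul_inv]
      · left; exact_mod_cast Fintype.card_ne_zero
      · left; exact ENNReal.natCast_ne_top _
    · intro b' _ hb'
      rw [if_neg]
      intro h
      exact hb' (Prod.ext_iff.1 (e.injective h)).2.symm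
    · simp
  · intro a' _ ha'
    rw [PMF.map_apply, tsum_fintype, Finset.sum_eq_zero, mul_zero]
    intro b' _
    rw [if_neg]
    intro h
    exact ha' (Prod.ext_iff.1 (e.injective h)).1.symm
  · simp

theorem uniform_bitStr_succ (k : ℕ) :
    PMF.uniformOfFintype (BitStr (k + 1)) = (PMF.uniformOfFintype Bool).bind fun b =>
      (PMF.uniformOfFintype (BitStr k)).map fun x => (Fin.snoc x b : BitStr (k + 1)) :=
  (uniformOfFintype_bind_map_equiv (Fin.snocEquiv fun _ : Fin (k + 1) => Bool)).symm

theorem ofFn_snoc {k : ℕ} (x : BitStr k) (b : Bool) :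
    List.ofFn (Fin.snoc x b : BitStr (k + 1)) = List.ofFn x ++ [b] := by
  rw [List.ofFn_succ']
  simp

theorem uniform_bitStr_zero : PMF.uniformOfFintype (BitStr 0) = PMF.pure ![] := by
  ext x
  have : x = ![] := Subsingleton.elim _ _
  subst this
  simp

/-- The halving process: a number between `0` and `m`, each with probability at least `1/(2m)`. -/
def pick (m : ℕ) : PMF ℕ :=
  if m = 0 then PMF.pure 0 else
    (PMF.uniformOfFintype Bool).bind fun b =>
      (pick (m / 2)).map fun k => k + if b then (m + 1) / 2 else 0
termination_by m
decreasing_by omega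

theorem pick_zero : pick 0 = PMF.pure 0 := by rw [pick, if_pos rfl]

theorem pick_pos {m : ℕ} (hm : m ≠ 0) : pick m = (PMF.uniformOfFintype Bool).bind fun b =>
    (pick (m / 2)).map fun k => k + if b then (m + 1) / 2 else 0 := by
  rw [pick, if_neg hm]

theorem pick_support (m k : ℕ) (hk : k ∈ (pick m).support) : k ≤ m := by
  induction m using Nat.strong_induction_on generalizing k with
  | _ m ih =>
    by_cases hm : m = 0
    · subst hm; rw [pick_zero, PMF.mem_support_pure_iff] at hk; omega
    · rw [pick_pos hm, PMF.mem_support_bind_iff] at hk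
      obtain ⟨b, _, hb⟩ := hk
      obtain ⟨j, hj, rfl⟩ := (PMF.mem_support_map_iff _ _ _).1 hb
      have := ih (m / 2) (by omega) j hj
      cases b <;> simp <;> omega

theorem le_pick_half {m k : ℕ} (hm : m ≠ 0) (b : Bool) :
    2⁻¹ * pick (m / 2) k ≤ pick m (k + if b then (m + 1) / 2 else 0) := by
  classical
  rw [pick_pos hm, PMF.bind_apply, tsum_fintype]
  refine le_trans ?_ (Finset.single_le_sum (fun _ _ => zero_le) (Finset.mem_univ b))
  rw [PMF.uniformOfFintype_apply, Fintype.card_bool]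
  refine mul_le_mul_right ?_ _
  rw [PMF.map_apply]
  exact le_trans (by simp) (ENNReal.le_tsum k)

/-- A coin tossed a bounded number of times cannot give a uniform choice unless the range is a power
of two; halving with overlap loses only a factor two. The induction runs on the stronger bound
1/(2m) for positive m, and 2m + 2 also covers m = 0. -/
theorem le_pick (m k : ℕ) (hk : k ≤ m) : ((2 * m + 2 : ℕ) : ℝ≥0∞)⁻¹ ≤ pick m k := by
  suffices h : ∀ m k, k ≤ m → m ≠ 0 → ((2 * m : ℕ) : ℝ≥0∞)⁻¹ ≤ pick m k by
    by_cases hm : m = 0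
    · subst hm
      obtain rfl : k = 0 := by omega
      rw [pick_zero, PMF.pure_apply_self]
      simp
    · refine le_trans ?_ (h m k hk hm)
      rw [ENNReal.inv_le_inv]
      exact_mod_cast (by omega)
  clear hk m k
  intro m
  induction m using Nat.strong_induction_on with
  | _ m ih =>
    intro k hk hm
    -- The two halves [0, m/2] and [(m+1)/2, m] have equal length and cover [0, m]; they share the
    -- midpoint when m is even.
    obtain ⟨b, j, hj, rfl⟩ : ∃ (b : Bool) (j : ℕ), j ≤ m / 2 ∧
        k = j + if b then (m + 1) / 2 else 0 := by
      by_cases h : k ≤ m / 2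
      · exact ⟨false, k, h, by simp⟩
      · exact ⟨true, k - (m + 1) / 2, by omega, by simp; omega⟩
    refine le_trans ?_ (le_pick_half hm b)
    by_cases h0 : m / 2 = 0
    · obtain rfl : m = 1 := by omega
      obtain rfl : j = 0 := by omega
      simp [pick_zero]
    · refine le_trans ?_ (mul_le_mul_right (ih (m / 2) (by omega) j hj h0) _)
      rw [← ENNReal.mul_inv (by simp) (by simp), ENNReal.inv_le_inv]
      have : 2 * (2 * (m / 2)) ≤ 2 * m := by omega
      exact_mod_cast this

/-! ### Registers of the inverter -/

/-- Contents of the registers that the inverter uses itself. -/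
structure Regs where
  /-- first input and output of the collision finder, and input of the inverter -/
  x : List Bool := []
  /-- input and output of the program for `f` -/
  fx : List Bool := []
  /-- the hash function, or the first point for the hash constructor -/
  g : List Bool := []
  /-- the prefix length, in unary -/
  i : List Bool := []
  /-- the value at the first point -/
  v : List Bool := []
  /-- the second point -/
  y : List Bool := []
  /-- the value at the second point -/
  w : List Bool := []
  /-- the input, reversed -/
  yr : List Bool := []
  /-- counter -/
  u : List Bool := []
  /-- counter -/
  rest : List Bool := []
  /-- counter -/
  i2 : List Bool := []
  /-- scratch -/
  t : List Bool := []
  /-- a coin -/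
  c : List Bool := []
  /-- nonempty if a difference was found -/
  flag : List Bool := []
  /-- counter -/
  tok : List Bool := []

/-- The store with these contents of the named registers, and contents `b` of the others. -/
def Regs.over (σ : Regs) (b : Store) : Store := fun r =>
  match r with
  | 0 => σ.x
  | 1 => σ.fx
  | 3 => σ.yr
  | 4 => σ.g
  | 6 => σ.v
  | 7 => σ.u
  | 8 => σ.i
  | 10 => σ.y
  | 11 => σ.rest
  | 14 => σ.w
  | 15 => σ.i2
  | 19 => σ.t
  | 23 => σ.c
  | 27 => σ.flag
  | 31 => σ.tok
  | r => b r

section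
variable (σ : Regs) (b : Store) (l : List Bool)

theorem over_0 : σ.over b 0 = σ.x := rfl
theorem over_1 : σ.over b 1 = σ.fx := rfl
theorem over_3 : σ.over b 3 = σ.yr := rfl
theorem over_4 : σ.over b 4 = σ.g := rfl
theorem over_6 : σ.over b 6 = σ.v := rfl
theorem over_7 : σ.over b 7 = σ.u := rfl
theorem over_8 : σ.over b 8 = σ.i := rfl
theorem over_10 : σ.over b 10 = σ.y := rfl
theorem over_11 : σ.over b 11 = σ.rest := rfl
theorem over_14 : σ.over b 14 = σ.w := rfl
theorem over_15 : σ.over b 15 = σ.i2 := rfl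
theorem over_19 : σ.over b 19 = σ.t := rfl
theorem over_23 : σ.over b 23 = σ.c := rfl
theorem over_27 : σ.over b 27 = σ.flag := rfl
theorem over_31 : σ.over b 31 = σ.tok := rfl

theorem eq_over {s : Store} (h0 : s 0 = σ.x) (h1 : s 1 = σ.fx) (h3 : s 3 = σ.yr) (h4 : s 4 = σ.g)
    (h6 : s 6 = σ.v) (h7 : s 7 = σ.u) (h8 : s 8 = σ.i) (h10 : s 10 = σ.y) (h11 : s 11 = σ.rest)
    (h14 : s 14 = σ.w) (h15 : s 15 = σ.i2) (h19 : s 19 = σ.t) (h23 : s 23 = σ.c)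
    (h27 : s 27 = σ.flag) (h31 : s 31 = σ.tok) : s = σ.over s := by
  funext r
  unfold Regs.over
  split <;> first | assumption | rfl

theorem update_over {r : ℕ} {σ' : Regs} (h : σ'.over b r = l)
    (h' : ∀ r' ≠ r, σ'.over b r' = σ.over b r') : Function.update (σ.over b) r l = σ'.over b := by
  funext r'
  by_cases hr : r' = r
  · subst hr; rw [Function.update_self, h]
  · rw [Function.update_of_ne hr, h' r' hr]

theorem upd_0 : Function.update (σ.over b) 0 l = { σ with x := l }.over b :=
  update_over _ _ _ rfl fun r' hr => by unfold Regs.over; split <;> first | rfl | exact (hr rfl).elim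
theorem upd_1 : Function.update (σ.over b) 1 l = { σ with fx := l }.over b :=
  update_over _ _ _ rfl fun r' hr => by unfold Regs.over; split <;> first | rfl | exact (hr rfl).elim
theorem upd_3 : Function.update (σ.over b) 3 l = { σ with yr := l }.over b :=
  update_over _ _ _ rfl fun r' hr => by unfold Regs.over; split <;> first | rfl | exact (hr rfl).elim
theorem upd_4 : Function.update (σ.over b) 4 l = { σ with g := l }.over b :=
  update_over _ _ _ rfl fun r' hr => by unfold Regs.over; split <;> first | rfl | exact (hr rfl).elim
theorem upd_6 : Function.update (σ.over b) 6 l = { σ with v := l }.over b :=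
  update_over _ _ _ rfl fun r' hr => by unfold Regs.over; split <;> first | rfl | exact (hr rfl).elim
theorem upd_7 : Function.update (σ.over b) 7 l = { σ with u := l }.over b :=
  update_over _ _ _ rfl fun r' hr => by unfold Regs.over; split <;> first | rfl | exact (hr rfl).elim
theorem upd_8 : Function.update (σ.over b) 8 l = { σ with i := l }.over b :=
  update_over _ _ _ rfl fun r' hr => by unfold Regs.over; split <;> first | rfl | exact (hr rfl).elim
theorem upd_10 : Function.update (σ.over b) 10 l = { σ with y := l }.over b :=
  update_over _ _ _ rfl fun r' hr => by unfold Regs.over; split <;> first | rfl | exact (hr rfl).elim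
theorem upd_11 : Function.update (σ.over b) 11 l = { σ with rest := l }.over b :=
  update_over _ _ _ rfl fun r' hr => by unfold Regs.over; split <;> first | rfl | exact (hr rfl).elim
theorem upd_14 : Function.update (σ.over b) 14 l = { σ with w := l }.over b :=
  update_over _ _ _ rfl fun r' hr => by unfold Regs.over; split <;> first | rfl | exact (hr rfl).elim
theorem upd_15 : Function.update (σ.over b) 15 l = { σ with i2 := l }.over b :=
  update_over _ _ _ rfl fun r' hr => by unfold Regs.over; split <;> first | rfl | exact (hr rfl).elim
theorem upd_19 : Function.update (σ.over b) 19 l = { σ with t := l }.over b :=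
  update_over _ _ _ rfl fun r' hr => by unfold Regs.over; split <;> first | rfl | exact (hr rfl).elim
theorem upd_23 : Function.update (σ.over b) 23 l = { σ with c := l }.over b :=
  update_over _ _ _ rfl fun r' hr => by unfold Regs.over; split <;> first | rfl | exact (hr rfl).elim
theorem upd_27 : Function.update (σ.over b) 27 l = { σ with flag := l }.over b :=
  update_over _ _ _ rfl fun r' hr => by unfold Regs.over; split <;> first | rfl | exact (hr rfl).elim
theorem upd_31 : Function.update (σ.over b) 31 l = { σ with tok := l }.over b :=
  update_over _ _ _ rfl fun r' hr => by unfold Regs.over; split <;> first | rfl | exact (hr rfl).elim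

end

attribute [simp] over_0 over_1 over_3 over_4 over_6 over_7 over_8 over_10 over_11 over_14 over_15
  over_19 over_23 over_27 over_31 upd_0 upd_1 upd_3 upd_4 upd_6 upd_7 upd_8 upd_10 upd_11 upd_14
  upd_15 upd_19 upd_23 upd_27 upd_31

/-! ### The parts of the inverter that sample its random choices -/

/-- Move the top bit of stack `a` to stack `b`. -/
def moveBit (a b : ℕ) : Prog :=
  .branch a .skip (.seq (.pop a) (.push b false)) (.seq (.pop a) (.push b true))

/-- Copy the top bit of stack `a` to stack `b`. -/
def copyBit (a b : ℕ) : Prog := .branch a .skip (.push b false) (.push b true)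

theorem Prog.Straight.runs_of_exec {p : Prog} (hp : p.Straight) {s s' : Store} {T : ℕ}
    (h : p.exec s = s') (hT : p.cost ≤ T) : Runs p s T (PMF.pure s') :=
  h ▸ (hp.runs s).mono hT

/-- Toss a coin and push the outcome on the stacks `a` and `b`; `r` is the loop counter. -/
def flipBoth (r a b : ℕ) : Prog := .seq (.pop r) (.seq (.flip a) (copyBit a b))

/-- Read the input, keep it reversed, and count its length. -/
def readInput : Prog :=
  .loop 0 (.seq (moveBit 0 3) (.seq (.push 7 true) (.seq (.push 11 true) (.push 31 true))))

theorem readInput_runs (y : List Bool) (b : Store) (yr u : List Bool) :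
    Runs readInput (({ x := y, yr := yr, u := u, rest := u, tok := u } : Regs).over b)
      (20 * y.length + 1)
      (PMF.pure (({
        yr := y.reverse ++ yr, u := List.replicate y.length true ++ u,
        rest := List.replicate y.length true ++ u,
        tok := List.replicate y.length true ++ u } : Regs).over b)) := by
  induction y generalizing yr u with
  | nil => exact (Runs.loop_nil rfl)
  | cons a y ih =>
    have h1 := Runs.loop_cons (r := 0) (T := 19) (ν := fun _ => _)
      (p := .seq (moveBit 0 3) (.seq (.push 7 true) (.seq (.push 11 true) (.push 31 true))))
      (s := ({ x := a :: y, yr := yr, u := u, rest := u, tok := u } : Regs).over b) (by simp)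
      (Prog.Straight.runs_of_exec (s' := ({
        x := y, yr := a :: yr, u := true :: u, rest := true :: u, tok := true :: u } : Regs).over b) (by simp [Prog.Straight, moveBit])
        (by cases a <;> simp [Prog.exec, moveBit]) (by decide))
      (fun s' hs' => by
        rw [PMF.mem_support_pure_iff] at hs'; subst hs'; exact ih (a :: yr) (true :: u))
    rw [PMF.pure_bind] at h1
    refine h1.cast (by simp; omega) ?_
    have : List.replicate y.length true ++ true :: u
        = List.replicate (a :: y).length true ++ u := by
      rw [List.append_cons, ← List.replicate_succ']; rfl
    rw [this]
    simp

/-- The state of two stacks after `k` rounds of pushing a random bit on both. -/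
def bothIter (k : ℕ) (a : List Bool × List Bool) : PMF (List Bool × List Bool) :=
  (PMF.uniformOfFintype (BitStr k)).map fun x => (List.ofFn x ++ a.1, List.ofFn x ++ a.2)

theorem bothIter_spec : (∀ a, bothIter 0 a = PMF.pure a) ∧ ∀ k a, bothIter (k + 1) a =
    ((PMF.uniformOfFintype Bool).map fun b => (b :: a.1, b :: a.2)).bind (bothIter k) := by
  unfold bothIter
  refine ⟨fun a => ?_, fun k a => ?_⟩
  · simp only [uniform_bitStr_zero, PMF.pure_map]; simp
  · simp only [uniform_bitStr_succ, PMF.map_bind, PMF.bind_map, PMF.map_comp]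
    congr 1
    funext b
    simp [Function.comp_def, ofFn_snoc, -List.ofFn_succ]

/-- The state of two stacks after `k` rounds of pushing independent random bits. -/
def eachIter (k : ℕ) (a : List Bool × List Bool) : PMF (List Bool × List Bool) :=
  (PMF.uniformOfFintype (BitStr k)).bind fun x =>
    (PMF.uniformOfFintype (BitStr k)).map fun z => (List.ofFn x ++ a.1, List.ofFn z ++ a.2)

theorem eachIter_spec : (∀ a, eachIter 0 a = PMF.pure a) ∧ ∀ k a, eachIter (k + 1) a =
    ((PMF.uniformOfFintype Bool).bind fun b =>
      (PMF.uniformOfFintype Bool).map fun b' => (b :: a.1, b' :: a.2)).bind (eachIter k) := by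
  unfold eachIter
  refine ⟨fun a => ?_, fun k a => ?_⟩
  · simp only [uniform_bitStr_zero, PMF.pure_map, PMF.pure_bind]; simp
  · simp only [uniform_bitStr_succ, PMF.map_bind, PMF.bind_map, PMF.map_comp, PMF.bind_bind]
    congr 1
    funext b
    simp only [Function.comp_def]
    refine (PMF.bind_comm _ _ _).trans (congrArg _ (funext fun b' => ?_))
    simp [ofFn_snoc, -List.ofFn_succ]

theorem Runs.flip_seq {r : ℕ} {p : Prog} {s : Store} {T : ℕ} {ν : Bool → PMF Store}
    (h : ∀ b, Runs p (Function.update s r (b :: s r)) T (ν b)) :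
    Runs (.seq (.flip r) p) s (T + 2) ((PMF.uniformOfFintype Bool).bind ν) :=
  ((Runs.flip r s).seq_map fun b _ => h b).mono (by omega)

theorem map_eq_bind_pure {α β : Type} (p : PMF α) (f : α → β) :
    p.map f = p.bind fun a => PMF.pure (f a) := rfl

theorem flipBoth_runs (r a b : ℕ) (s : Store) : Runs (flipBoth r a b) s 19
    ((PMF.uniformOfFintype Bool).map fun c => (copyBit a b).exec
      (Function.update (Function.update s r (s r).tail) a
        (c :: Function.update s r (s r).tail a))) := by
  rw [map_eq_bind_pure]
  exact (Runs.seq_pure (Runs.pop r s) (Runs.flip_seq (T := 10) fun c =>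
    Prog.Straight.runs_of_exec (by simp [Prog.Straight, copyBit]) rfl (by simp [copyBit, Prog.cost]))).mono
    (by omega)

/-- Sample `x`, in two copies. -/
def sampleInput : Prog := .loop 31 (flipBoth 31 1 0)

theorem sampleInput_runs (σ : Regs) (b : Store) (n : ℕ) :
    Runs sampleInput
      ({ σ with x := [], fx := [], tok := List.replicate n true }.over b) (20 * n + 1)
      ((PMF.uniformOfFintype (BitStr n)).map fun x =>
        { σ with x := List.ofFn x, fx := List.ofFn x, tok := [] }.over b) := by
  have := Runs.loop_counter (r := 31) (p := flipBoth 31 1 0) (T := 19)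
    (fun k a => { σ with fx := a.1, x := a.2, tok := List.replicate k true }.over b)
    (fun a => (PMF.uniformOfFintype Bool).map fun b => (b :: a.1, b :: a.2))
    (fun k a => by simp) (fun k a => by
      rw [PMF.map_comp]
      refine (flipBoth_runs _ _ _ _).cast le_rfl (congrArg (PMF.map · _) (funext fun c => ?_))
      cases c <;> simp [Prog.exec, copyBit, List.replicate_succ])
    _ bothIter_spec.1 bothIter_spec.2 n ([], [])
  simpa [bothIter, PMF.map_comp, Function.comp_def, sampleInput, Nat.mul_comm] using this

/-- Sample the suffixes of the two hash values. -/
def sampleSuffix : Prog :=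
  .loop 11 (.seq (.pop 11) (.seq (.flip 6) (.flip 14)))

theorem sampleSuffix_runs (σ : Regs) (b : Store) (n : ℕ) :
    Runs sampleSuffix
      ({ σ with v := [], w := [], rest := List.replicate n true }.over b) (20 * n + 1)
      ((PMF.uniformOfFintype (BitStr n)).bind fun x => (PMF.uniformOfFintype (BitStr n)).map fun z =>
        { σ with v := List.ofFn x, w := List.ofFn z, rest := [] }.over b) := by
  have := Runs.loop_counter (r := 11) (p := .seq (.pop 11) (.seq (.flip 6) (.flip 14))) (T := 19)
    (fun k a => { σ with v := a.1, w := a.2, rest := List.replicate k true }.over b)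
    (fun a => (PMF.uniformOfFintype Bool).bind fun b =>
      (PMF.uniformOfFintype Bool).map fun b' => (b :: a.1, b' :: a.2))
    (fun k a => by simp) (fun k a => by
      refine (Runs.seq_pure (Runs.pop _ _) (Runs.flip_seq (T := 10) fun c =>
        (Runs.flip _ _).mono (by omega))).cast (by omega) ?_
      rw [PMF.map_bind]
      refine congrArg _ (funext fun c => ?_)
      rw [PMF.map_comp]
      refine congrArg (PMF.map · _) (funext fun c' => ?_)
      simp [List.replicate_succ])
    _ eachIter_spec.1 eachIter_spec.2 n ([], [])
  simpa [eachIter, PMF.map_comp, PMF.map_bind, Function.comp_def, sampleSuffix, Nat.mul_comm] using this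

/-- Sample the common prefix of the two hash values. -/
def samplePrefix : Prog := .loop 15 (flipBoth 15 6 14)

theorem samplePrefix_runs (σ : Regs) (b : Store) (n : ℕ) (v w : List Bool) :
    Runs samplePrefix
      ({ σ with v := v, w := w, i2 := List.replicate n true }.over b) (20 * n + 1)
      ((PMF.uniformOfFintype (BitStr n)).map fun x =>
        { σ with v := List.ofFn x ++ v, w := List.ofFn x ++ w, i2 := [] }.over b) := by
  have := Runs.loop_counter (r := 15) (p := flipBoth 15 6 14) (T := 19)
    (fun k a => { σ with v := a.1, w := a.2, i2 := List.replicate k true }.over b)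
    (fun a => (PMF.uniformOfFintype Bool).map fun b => (b :: a.1, b :: a.2))
    (fun k a => by simp) (fun k a => by
      rw [PMF.map_comp]
      refine (flipBoth_runs _ _ _ _).cast le_rfl (congrArg (PMF.map · _) (funext fun c => ?_))
      cases c <;> simp [Prog.exec, copyBit, List.replicate_succ])
    _ bothIter_spec.1 bothIter_spec.2 n (v, w)
  simpa [bothIter, PMF.map_comp, Function.comp_def, samplePrefix, Nat.mul_comm] using this

/-- One round of halving the counter: every other token is kept, and if the coin shows `true` then
the other tokens are added to the prefix length. -/
def halveBody : Prog :=
  .seq (.pop 7) (.seq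
    (.branch 23 .skip .skip (.seq (.push 8 true) (.seq (.push 15 true) (.pop 11))))
    (moveBit 7 19))

/-- Registers during the sampling of the prefix length. -/
def Regs.halving (σ : Regs) (m t p r : ℕ) (c : List Bool) : Regs :=
  { σ with
    u := List.replicate m true, t := List.replicate t true, i := List.replicate p true
    i2 := List.replicate p true, rest := List.replicate r true, c := c }

theorem halveBody_exec (σ : Regs) (b : Store) (m t p r : ℕ) (c : Bool) :
    halveBody.exec ((σ.halving (m + 1) t p r [c]).over b)
      = (σ.halving (m - 1) (t + if m = 0 then 0 else 1) (p + if c then 1 else 0)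
          (r - if c then 1 else 0) [c]).over b := by
  rcases m with _ | m <;> cases c <;> rcases r with _ | r <;>
    simp [halveBody, moveBit, Prog.exec, Regs.halving, List.replicate_succ]

/-- Each round uses up one token and sets aside the next, if any, so m tokens give (m+1)/2 rounds
and leave m/2 tokens, matching the recursion of `pick`. -/
theorem halve_runs (σ : Regs) (b : Store) (m t p r : ℕ) (c : Bool) :
    Runs (.loop 7 halveBody) ((σ.halving m t p r [c]).over b) (30 * m + 1)
      (PMF.pure ((σ.halving 0 (t + m / 2) (p + if c then (m + 1) / 2 else 0)
          (r - if c then (m + 1) / 2 else 0) [c]).over b)) := by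
  induction m using Nat.strong_induction_on generalizing t p r with
  | _ m ih =>
    rcases m with _ | m
    · simpa using (Runs.loop_nil (r := 7) (p := halveBody) (s := (σ.halving 0 t p r [c]).over b)
        (by simp [Regs.halving]))
    · have h1 := Runs.loop_cons (r := 7) (T := 29) (ν := fun _ => _) (p := halveBody)
        (s := (σ.halving (m + 1) t p r [c]).over b) (by simp [Regs.halving])
        (Prog.Straight.runs_of_exec (by simp [Prog.Straight, halveBody, moveBit])
          (halveBody_exec σ b m t p r c) (by decide))
        (fun s' hs' => by
          rw [PMF.mem_support_pure_iff] at hs'; subst hs'; exact ih _ (by omega) _ _ _)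
      rw [PMF.pure_bind] at h1
      refine h1.cast (by omega) ?_
      have e1 : (t + if m = 0 then 0 else 1) + (m - 1) / 2 = t + (m + 1) / 2 := by
        split_ifs <;> omega
      rw [e1]
      cases c
      · simp
      · have e2 : p + 1 + (m - 1 + 1) / 2 = p + (m + 1 + 1) / 2 := by
          rcases m with _ | m <;> simp; omega
        have e3 : r - 1 - (m - 1 + 1) / 2 = r - (m + 1 + 1) / 2 := by
          rcases m with _ | m <;> simp; omega
        simp only [if_true, e2, e3]

theorem moveBack_runs (σ : Regs) (b : Store) (m t p r : ℕ) (c : List Bool) :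
    Runs (.loop 19 (.seq (.pop 19) (.push 7 true))) ((σ.halving m t p r c).over b) (10 * t + 1)
      (PMF.pure ((σ.halving (m + t) 0 p r c).over b)) := by
  induction t generalizing m with
  | zero => exact Runs.loop_nil (by simp [Regs.halving])
  | succ t ih =>
    have h1 := Runs.loop_cons (r := 19) (T := 9) (ν := fun _ => _)
      (p := .seq (.pop 19) (.push 7 true))
      (s := (σ.halving m (t + 1) p r c).over b) (by simp [Regs.halving])
      (Prog.Straight.runs_of_exec (s' := (σ.halving (m + 1) t p r c).over b)
        (by simp [Prog.Straight]) (by simp [Prog.exec, Regs.halving, List.replicate_succ])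
        (by decide))
      (fun s' hs' => by
        rw [PMF.mem_support_pure_iff] at hs'; subst hs'; exact ih (m + 1))
    rw [PMF.pure_bind, show m + 1 + t = m + (t + 1) by omega] at h1
    exact h1.mono (by omega)

/-- Sample the prefix length. -/
def sampleLength : Prog :=
  .loop 7 (.seq (.flip 23) (.seq (.loop 7 halveBody)
    (.seq (.loop 19 (.seq (.pop 19) (.push 7 true))) (.pop 23))))

theorem sampleLength_runs (σ : Regs) (b : Store) (m p r : ℕ) :
    Runs sampleLength ((σ.halving m 0 p r []).over b) (100 * m + 1)
      ((pick m).map fun k => (σ.halving 0 0 (p + k) (r - k) []).over b) := by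
  induction m using Nat.strong_induction_on generalizing p r with
  | _ m ih =>
    by_cases hm : m = 0
    · subst hm
      rw [pick_zero, PMF.pure_map]
      exact Runs.loop_nil (by simp [Regs.halving])
    · have hbody : Runs (.seq (.flip 23) (.seq (.loop 7 halveBody)
          (.seq (.loop 19 (.seq (.pop 19) (.push 7 true))) (.pop 23))))
          ((σ.halving m 0 p r []).over b) (30 * m + 5 * m + 11)
          ((PMF.uniformOfFintype Bool).map fun c =>
            (σ.halving (m / 2) 0 (p + if c then (m + 1) / 2 else 0)
              (r - if c then (m + 1) / 2 else 0) []).over b) := by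
        rw [map_eq_bind_pure]
        refine (Runs.flip_seq (T := 30 * m + 5 * m + 9) fun c => ?_).mono (by omega)
        have e : Function.update ((σ.halving m 0 p r []).over b) 23
            (c :: (σ.halving m 0 p r []).over b 23) = (σ.halving m 0 p r [c]).over b := by
          simp [Regs.halving]
        rw [e]
        refine ((halve_runs σ b m 0 p r c).seq_pure ((moveBack_runs σ b 0 (0 + m / 2) _ _ [c]).seq_pure
          (Runs.pop 23 _))).cast (by omega) ?_
        simp [Regs.halving]
      have h1 := Runs.loop_cons (r := 7) (by simp [Regs.halving, hm]) hbody (T' := 100 * (m / 2) + 1)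
        -- `loop_cons` wants the result as a function of the store, so it is given as the actual
        -- distribution after enough steps; the induction hypothesis evaluates it.
        (ν := fun s' => (stepN (100 * (m / 2) + 1) ([sampleLength], s')).map Prod.snd)
        (fun s' hs' => by
          obtain ⟨c, _, rfl⟩ := (PMF.mem_support_map_iff _ _ _).1 hs'
          have := ih (m / 2) (by omega) (p + if c then (m + 1) / 2 else 0)
              (r - if c then (m + 1) / 2 else 0)
          rw [(this []).stepN_eq, PMF.map_comp]
          simpa [Function.comp_def, PMF.map, PMF.bind_pure, sampleLength] using this)
      rw [PMF.bind_map] at h1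
      refine h1.cast (by omega) ?_
      rw [pick_pos hm, PMF.map_bind]
      congr 2
      funext c
      have := ih (m / 2) (by omega) (p + if c then (m + 1) / 2 else 0)
              (r - if c then (m + 1) / 2 else 0)
      simp only [Function.comp]
      rw [(this []).stepN_eq]
      simp only [PMF.map_comp, Function.comp_def]
      refine congrArg (PMF.map · _) (funext fun k => ?_)
      generalize (if c = true then (m + 1) / 2 else 0) = q
      rw [show p + q + k = p + (k + q) by omega, show r - q - k = r - (k + q) by omega]

/-! ### Comparing two strings -/

theorem reverse_runs (σ : Regs) (b : Store) (l t : List Bool) :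
    Runs (.loop 1 (moveBit 1 19)) ({ σ with fx := l, t := t }.over b) (20 * l.length + 1)
      (PMF.pure ({ σ with fx := [], t := l.reverse ++ t }.over b)) := by
  induction l generalizing t with
  | nil => exact Runs.loop_nil rfl
  | cons a l ih =>
    have h1 := Runs.loop_cons (r := 1) (T := 19) (ν := fun _ => _) (p := moveBit 1 19)
      (s := { σ with fx := a :: l, t := t }.over b) (by simp)
      (Prog.Straight.runs_of_exec (s' := { σ with fx := l, t := a :: t }.over b)
        (by simp [Prog.Straight, moveBit]) (by cases a <;> simp [Prog.exec, moveBit]) (by decide))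
      (fun s' hs' => by
        rw [PMF.mem_support_pure_iff] at hs'; subst hs'; exact ih (a :: t))
    rw [PMF.pure_bind] at h1
    exact Runs.cast h1 (by simp; omega) (by simp)

/-- Compare the strings (reversed) on the stacks `19` and `3`, and move them to the stacks `4` and
`10`. -/
def compareLoop : Prog :=
  .loop 19 (.seq
    (.branch 19 .skip (.branch 3 .skip .skip (.push 27 true)) (.branch 3 .skip (.push 27 true) .skip))
    (.seq (moveBit 19 4) (moveBit 3 10)))

theorem compare_runs (σ : Regs) (b : Store) (l l' g y fl : List Bool) (hl : l.length = l'.length) :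
    ∃ fl', Runs compareLoop ({ σ with t := l, yr := l', g := g, y := y, flag := fl }.over b)
      (40 * l.length + 1)
      (PMF.pure ({ σ with
        t := [], yr := [], g := l.reverse ++ g, y := l'.reverse ++ y, flag := fl' }.over b)) ∧
      (fl' = [] ↔ fl = [] ∧ l = l') := by
  induction l generalizing l' g y fl with
  | nil =>
    obtain rfl : l' = [] := List.eq_nil_of_length_eq_zero hl.symm
    exact ⟨fl, Runs.loop_nil rfl, by simp⟩
  | cons a l ih =>
    obtain ⟨a', l', rfl⟩ : ∃ a' m, l' = a' :: m := List.exists_cons_of_length_eq_add_one hl.symm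
    obtain ⟨fl', h, hfl⟩ := ih l' (a :: g) (a' :: y) (if a = a' then fl else true :: fl)
      (by simpa using hl)
    refine ⟨fl', ?_, ?_⟩
    · have h1 := Runs.loop_cons (r := 19) (T := 39) (ν := fun _ => _)
        (s := { σ with t := a :: l, yr := a' :: l', g := g, y := y, flag := fl }.over b) (by simp)
        (Prog.Straight.runs_of_exec
          (p := .seq
            (.branch 19 .skip (.branch 3 .skip .skip (.push 27 true))
              (.branch 3 .skip (.push 27 true) .skip))
            (.seq (moveBit 19 4) (moveBit 3 10)))
          (s' := { σ with
            t := l, yr := l', g := a :: g, y := a' :: y,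
            flag := if a = a' then fl else true :: fl }.over b)
          (by simp [Prog.Straight, moveBit])
          (by cases a <;> cases a' <;> simp [Prog.exec, moveBit]) (by decide))
        (fun s' hs' => by
          rw [PMF.mem_support_pure_iff] at hs'; subst hs'; exact h)
      rw [PMF.pure_bind] at h1
      exact Runs.cast h1 (by simp; omega) (by simp)
    · rw [hfl]
      by_cases ha : a = a' <;> simp [ha]

/-! ### Calling the given programs -/

/-- The registers of the collision finder. -/
def regA (r : ℕ) : ℕ := 4 * r
/-- The registers of the program for the one-way function. -/
def regF (r : ℕ) : ℕ := 4 * r + 1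
/-- The registers of the hash constructor. -/
def regC (r : ℕ) : ℕ := if r = 0 then 4 else 4 * r + 2

/-- Residues modulo 4 separate the collision finder (0), the program for f (1), the hash constructor
(2) and the inverter's own scratch (3). The one overlap, `regC 0 = regA 1 = 4`, hands the
constructed hash function to the collision finder without copying. -/
theorem regA_injective : regA.Injective := fun a b h => by unfold regA at h; omega
theorem regF_injective : regF.Injective := fun a b h => by unfold regF at h; omega
theorem regC_injective : regC.Injective := fun a b h => by
  unfold regC at h; split_ifs at h <;> omega

theorem over_of_not_mem (σ : Regs) (b : Store) {r : ℕ}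
    (h : r ∉ [0, 1, 3, 4, 6, 7, 8, 10, 11, 14, 15, 19, 23, 27, 31]) : σ.over b r = b r := by
  unfold Regs.over
  split <;> first | rfl | simp at h

theorem extend_regF (σ : Regs) (b t : Store) :
    Function.extend regF t (σ.over b)
      = { σ with fx := t 0 }.over (Function.extend regF t (σ.over b)) := by
  have h : ∀ r, r % 4 ≠ 1 → Function.extend regF t (σ.over b) r = σ.over b r := fun r hr =>
    Function.extend_apply' _ _ _ fun ⟨a, ha⟩ => hr (by unfold regF at ha; omega)
  have h1 : Function.extend regF t (σ.over b) 1 = t 0 := regF_injective.extend_apply t _ 0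
  exact eq_over _ (h 0 (by decide)) h1 (h 3 (by decide)) (h 4 (by decide)) (h 6 (by decide))
    (h 7 (by decide)) (h 8 (by decide)) (h 10 (by decide)) (h 11 (by decide)) (h 14 (by decide))
    (h 15 (by decide)) (h 19 (by decide)) (h 23 (by decide)) (h 27 (by decide)) (h 31 (by decide))

/-- The part of the inverter that calls the hash constructor and the collision finder. -/
def attack (pc pa : Prog) : Prog := .seq (pc.rename regC) (pa.rename regA)

/-- The part of the inverter that follows the sampling of the random choices. -/
def finish (pf pc pa : Prog) : Prog :=
  .seq (pf.rename regF) (.seq (.loop 1 (moveBit 1 19)) (.seq compareLoop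
    (.branch 27 .skip (attack pc pa) (attack pc pa))))

/-- The even registers that are not named are empty. -/
def EvenEmpty (b : Store) : Prop :=
  ∀ r, r ∉ [0, 1, 3, 4, 6, 7, 8, 10, 11, 14, 15, 19, 23, 27, 31] → r % 2 = 0 → b r = []

theorem Prog.HaltsWithin.wins_regA {pa : Prog} {xs : List (List Bool)} {T : ℕ}
    (h : pa.HaltsWithin xs T) {s : Store} (hs : ∀ r, s (regA r) = initStore xs r)
    (P : List Bool → Prop) :
    Wins (pa.rename regA) s T {s | P (s 0)}
      ((pa.run xs T).toOuterMeasure {c | P (c.2 0)}) := by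
  refine ⟨_, h.runs_rename regA_injective hs, ?_⟩
  rw [PMF.toOuterMeasure_map_apply]
  refine le_of_eq (congrArg _ ?_)
  ext c
  simp only [Set.mem_ofPred_eq, Set.mem_preimage]
  rw [show (0 : ℕ) = regA 0 from rfl, regA_injective.extend_apply]
  rfl

section
variable {G : HashFamily} {n : ℕ}

-- The constructor yields each fitting hash function with probability 1/N, where N counts those
-- functions; averaging the collision finder's success over this choice gives the sum.
open Classical in
theorem attack_wins {pc pa : Prog} {TC TA : ℕ} (c : TwoPoint n) (hc : pc.HaltsWithin c.enc TC)
    (hout : ∀ g, G.Fits c g → pc.outProb c.enc (fun s => Holds s [g.1])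
      = 1 / (Nat.card {g' : G.keys n // G.Fits c g'} : ℝ))
    (hfit : ∃ g, G.Fits c g) (x ones : List Bool)
    (ha : ∀ g : G.keys n, pa.HaltsWithin [x, g.1, ones] TA) (P : List Bool → Prop)
    (σ : Regs) (b : Store) (hb : EvenEmpty b) (hx : σ.x = x) (hi : σ.i = ones)
    (h4 : σ.g = List.ofFn c.x₁) (h6 : σ.v = List.ofFn c.y₁) (h10 : σ.y = List.ofFn c.x₂)
    (h14 : σ.w = List.ofFn c.y₂) :
    Wins (attack pc pa) (σ.over b) (TC + TA + 1) {s | P (s 0)}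
      (∑ g : G.keys n, if G.Fits c g then (Nat.card {g' : G.keys n // G.Fits c g'} : ℝ≥0∞)⁻¹ *
        (pa.run [x, g.1, ones] TA).toOuterMeasure {c | P (c.2 0)} else 0) := by
  set N : ℕ := Nat.card {g' : G.keys n // G.Fits c g'} with hN
  set S : G.keys n → ℝ≥0∞ := fun g =>
    (pa.run [x, g.1, ones] TA).toOuterMeasure {c | P (c.2 0)} with hS
  set μ := pc.run c.enc TC with hμ
  have hN0 : N ≠ 0 := by
    obtain ⟨g, hg⟩ := hfit
    have : Nonempty {g' : G.keys n // G.Fits c g'} := ⟨⟨g, hg⟩⟩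
    exact Nat.card_pos.ne'
  have hprob : ∀ g, G.Fits c g → μ.toOuterMeasure {k | k.2 0 = g.1} = (N : ℝ≥0∞)⁻¹ := by
    intro g hg
    have h := hout g hg
    rw [hc.outProb_eq] at h
    have e : {k : Config | Holds k.2 [g.1]} = {k | k.2 0 = g.1} := by
      ext k
      simp [Holds]
    rw [e, ← hμ] at h
    rw [← ENNReal.ofReal_toReal (toOuterMeasure_ne_top μ _), h, one_div,
      ENNReal.ofReal_inv_of_pos (by positivity), ENNReal.ofReal_natCast]
  have hsum : ∀ a : G.keys n → ℝ≥0∞,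
      ∑' k, μ k * ∑ g : G.keys n, (if G.Fits c g ∧ k.2 0 = g.1 then a g else 0)
        = ∑ g : G.keys n, if G.Fits c g then (N : ℝ≥0∞)⁻¹ * a g else 0 := by
    intro a
    simp_rw [Finset.mul_sum]
    rw [Summable.tsum_finsetSum (fun _ _ => ENNReal.summable)]
    refine Finset.sum_congr rfl fun g _ => ?_
    by_cases hg : G.Fits c g
    · rw [if_pos hg, ← hprob g hg, PMF.toOuterMeasure_apply, ← ENNReal.tsum_mul_right]
      refine tsum_congr fun k => ?_
      by_cases hk : k.2 0 = g.1
      · rw [if_pos ⟨hg, hk⟩, Set.indicator_of_mem (by exact hk)]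
      · rw [if_neg (fun h => hk h.2), Set.indicator_of_notMem (by exact hk), mul_zero, zero_mul]
    · rw [if_neg hg]
      simp [hg]
  have hone : ∑' k, μ k * ∑ g : G.keys n, (if G.Fits c g ∧ k.2 0 = g.1 then (1 : ℝ≥0∞) else 0)
      = 1 := by
    rw [hsum, ← Finset.sum_filter, Finset.sum_const, mul_one, nsmul_eq_mul]
    have : (Finset.univ.filter fun g : G.keys n => G.Fits c g).card = N := by
      rw [hN, Nat.card_eq_fintype_card, Fintype.card_subtype]
    rw [this, ENNReal.mul_inv_cancel (by exact_mod_cast hN0) (ENNReal.natCast_ne_top _)]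
  have huniq : ∀ (k : Config) (g : G.keys n), G.Fits c g → k.2 0 = g.1 → ∀ a : G.keys n → ℝ≥0∞,
      ∑ g : G.keys n, (if G.Fits c g ∧ k.2 0 = g.1 then a g else 0) = a g := by
    intro k g hg hk a
    rw [Finset.sum_eq_single g (fun g' _ hne => if_neg fun h => hne (Subtype.ext (h.2.symm.trans hk)))
      (fun h => absurd (Finset.mem_univ g) h), if_pos ⟨hg, hk⟩]
  -- The N fitting functions already account for total probability N · (1/N) = 1, so no other output
  -- has positive probability. Hence the collision finder is always called on a legitimate input,
  -- where its time bound applies.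
  have hsupp : ∀ k ∈ μ.support, ∃ g, G.Fits c g ∧ k.2 0 = g.1 := by
    intro k hk
    by_contra hno
    push Not at hno
    have hlt : ∑' j, μ j * ∑ g : G.keys n, (if G.Fits c g ∧ j.2 0 = g.1 then (1 : ℝ≥0∞) else 0)
        < ∑' j, μ j := by
      refine ENNReal.tsum_lt_tsum (i := k) ?_ (fun j => ?_) ?_
      · rw [hone]; exact ENNReal.one_ne_top
      · by_cases hj : ∃ g, G.Fits c g ∧ j.2 0 = g.1
        · obtain ⟨g, hg, hgj⟩ := hj
          rw [huniq j g hg hgj, mul_one]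
        · push Not at hj
          rw [Finset.sum_eq_zero fun g _ => if_neg fun h => hj g h.1 h.2, mul_zero]
          exact zero_le
      · rw [Finset.sum_eq_zero fun g _ => if_neg fun h => hno g h.1 h.2, mul_zero]
        exact pos_iff_ne_zero.2 hk
    rw [hone, PMF.tsum_coe] at hlt
    exact lt_irrefl _ hlt
  have hs : ∀ r, σ.over b (regC r) = initStore c.enc r := by
    intro r
    match r with
    | 0 => exact h4
    | 1 => exact h6
    | 2 => exact h10
    | 3 => exact h14
    | r + 4 =>
      have e : regC (r + 4) = 4 * (r + 4) + 2 := by simp [regC]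
      rw [e, over_of_not_mem _ _ (by simp; omega), hb _ (by simp; omega) (by omega)]
      simp [initStore, TwoPoint.enc]
  rw [← hsum S]
  refine Wins.seq (hc.runs_rename regC_injective hs) fun k hk => ?_
  obtain ⟨g, hg, hgk⟩ := hsupp k hk
  rw [huniq k g hg hgk]
  -- The constructor leaves garbage only in registers that the collision finder does not see, apart
  -- from register 4.
  have hout : ∀ r, r ≠ 4 → r % 4 ≠ 2 →
      Function.extend regC k.2 (σ.over b) r = σ.over b r := fun r h h' =>
    Function.extend_apply' _ _ _ fun ⟨a, ha⟩ => by
      unfold regC at ha; split_ifs at ha <;> omega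
  refine (ha g).wins_regA (fun r => ?_) P
  match r with
  | 0 => exact (hout 0 (by decide) (by decide)).trans hx
  | 1 => exact (regC_injective.extend_apply k.2 _ 0).trans hgk
  | 2 => exact (hout 8 (by decide) (by decide)).trans hi
  | r + 3 =>
    have e : regA (r + 3) = 4 * (r + 3) := rfl
    rw [e, hout _ (by omega) (by omega), over_of_not_mem _ _ (by simp; omega),
      hb _ (by simp; omega) (by omega)]
    simp [initStore]

theorem Wins.branch_nil {r : ℕ} {p q t : Prog} {s : Store} {T : ℕ} {E : Set Store} {a : ℝ≥0∞}
    (hs : s r = []) (h : Wins p s T E a) : Wins (.branch r p q t) s (T + 1) E a :=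
  let ⟨μ, h1, h2⟩ := h
  ⟨μ, h1.branch_nil hs, h2⟩

theorem Wins.branch_cons {r : ℕ} {p q : Prog} {s : Store} {T : ℕ} {E : Set Store} {a : ℝ≥0∞}
    (hs : s r ≠ []) (h : Wins q s T E a) : Wins (.branch r p q q) s (T + 1) E a := by
  obtain ⟨μ, h1, h2⟩ := h
  obtain ⟨_ | _, l, hb⟩ := List.exists_cons_of_ne_nil hs
  · exact ⟨μ, h1.branch_false hb, h2⟩
  · exact ⟨μ, h1.branch_true hb, h2⟩

/-- The value that the final part of the inverter achieves: `1` if the sampled `x` is itself a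
preimage, otherwise the probability that the collision finder produces one. -/
theorem finish_wins {fn : BitStr n → BitStr n} {pf pc pa : Prog} {TF TC TA : ℕ} (x y v w : BitStr n)
    (hf : pf.HaltsWithin [List.ofFn x] TF)
    (hfo : pf.AlwaysOutputs [List.ofFn x] fun s => Holds s [List.ofFn (fn x)])
    (ones : List Bool) (P : List Bool → Prop) (a : ℝ≥0∞) (hP : fn x = y → P (List.ofFn x) ∧ a ≤ 1)
    (σ : Regs) (hx : σ.x = List.ofFn x) (hfx : σ.fx = List.ofFn x) (hi : σ.i = ones)
    (h4 : σ.g = []) (h6 : σ.v = List.ofFn v) (h10 : σ.y = []) (h14 : σ.w = List.ofFn w)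
    (hyr : σ.yr = (List.ofFn y).reverse) (ht : σ.t = []) (hflag : σ.flag = [])
    (hatt : fn x ≠ y → ∀ (σ : Regs) (b : Store), EvenEmpty b →
      σ.x = List.ofFn x → σ.i = ones → σ.g = List.ofFn (fn x) → σ.v = List.ofFn v →
      σ.y = List.ofFn y → σ.w = List.ofFn w →
      Wins (attack pc pa) (σ.over b) (TC + TA + 1) {s | P (s 0)} a) :
    Wins (finish pf pc pa) (σ.over fun _ => []) (TF + TC + TA + 60 * n + 10) {s | P (s 0)} a := by
  have hs : ∀ r, σ.over (fun _ => []) (regF r) = initStore [List.ofFn x] r := by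
    intro r
    match r with
    | 0 => exact hfx
    | r + 1 =>
      rw [over_of_not_mem _ _ (by simp [regF]; omega)]
      simp [initStore]
  refine Wins.mono (Wins.seq_const (T' := TC + TA + 60 * n + 9)
    (hf.runs_rename regF_injective hs) fun k hk => ?_) (by omega) le_rfl
  have hk0 : k.2 0 = List.ofFn (fn x) := hfo TF k hk (hf k hk) 0 (by simp)
  set b := Function.extend regF k.2 (σ.over fun _ => []) with hb
  have hbe : EvenEmpty b := by
    intro r hr hr2
    rw [hb, Function.extend_apply' _ _ _ fun ⟨a, ha⟩ => by unfold regF at ha; omega,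
      over_of_not_mem _ _ hr]
  rw [hb, extend_regF, ← hb, hk0]
  have e1 : ({ σ with fx := List.ofFn (fn x) } : Regs)
      = { { σ with fx := List.ofFn (fn x) } with fx := List.ofFn (fn x), t := [] } := by
    rw [← ht]
  rw [e1]
  have hrev := reverse_runs { σ with fx := List.ofFn (fn x) } b (List.ofFn (fn x)) []
  obtain ⟨fl, hcmp, hfl⟩ := compare_runs { σ with fx := [] } b (List.ofFn (fn x)).reverse
    (List.ofFn y).reverse [] [] [] (by simp)
  refine Wins.mono (Wins.seq_pure hrev (T' := 40 * n + TC + TA + 6) ?_) (by simp; omega) le_rfl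
  have e2 : ({ σ with fx := [], t := (List.ofFn (fn x)).reverse ++ [] } : Regs)
      = { { σ with fx := [] } with
          t := (List.ofFn (fn x)).reverse, yr := (List.ofFn y).reverse, g := [], y := [],
          flag := [] } := by
    simp [h4, h10, hyr, hflag]
  simp only at e2 ⊢
  rw [e2]
  refine Wins.mono (Wins.seq_pure hcmp (T' := TC + TA + 2) ?_) (by simp; omega) le_rfl
  simp only [List.reverse_reverse, List.append_nil]
  by_cases hxy : fn x = y
  · have hfl' : fl = [] := hfl.2 ⟨rfl, by rw [hxy]⟩
    refine Wins.mono (Wins.branch_nil (T := 1) hfl' ((Runs.skip _).wins_pure ?_)) (by omega)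
      (hP hxy).2
    -- Register 0 still holds the copy of `x` made during sampling, which is itself the preimage to
    -- be output.
    show P σ.x
    rw [hx]
    exact (hP hxy).1
  · have hfl' : fl ≠ [] := by
      intro h
      have := (hfl.1 h).2
      exact hxy (List.ofFn_injective (List.reverse_injective this))
    exact Wins.mono (Wins.branch_cons (T := TC + TA + 1) hfl'
      (hatt hxy _ b hbe hx hi rfl h6 rfl h14)) (by omega) le_rfl

end

/-! ### The inverter -/

/-- The part of the inverter that follows the reading of the input. -/
def inverterMain (pf pc pa : Prog) : Prog :=
  .seq sampleInput (.seq (.seq (.push 8 true) (.seq (.push 15 true) (.pop 11)))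
    (.seq sampleLength (.seq sampleSuffix (.seq samplePrefix (finish pf pc pa)))))

/-- The inverter: it samples `x`, a prefix length `i`, and a hash function `g` for which `x` and the
input `y` collide, that is `g(f(x))_{1…i} = g(y)_{1…i}`, and runs the collision finder on
`(x, g, i)`. -/
def inverter (pf pc pa : Prog) : Prog :=
  .seq readInput (.seq (.pop 7)
    (.branch 7 .skip (inverterMain pf pc pa) (inverterMain pf pc pa)))

theorem exists_ofFn_eq {n : ℕ} (l : List Bool) (h : l.length = n) :
    ∃ v : BitStr n, List.ofFn v = l := by
  subst h
  exact ⟨l.get, List.ofFn_get l⟩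

section
variable (G : HashFamily) {n : ℕ} (fn : BitStr n → BitStr n) (pa : Prog) (TA : ℕ)

/-- The hash values of `f(x)` and `y` have the same first `i` bits. -/
def PrefixEq (i : ℕ) (g : G.keys n) (u v : BitStr n) : Prop :=
  (List.ofFn (G.eval n g u)).take i = (List.ofFn (G.eval n g v)).take i

instance (i : ℕ) (g : G.keys n) (u v : BitStr n) : Decidable (PrefixEq G i g u v) :=
  inferInstanceAs (Decidable ((List.ofFn (G.eval n g u)).take i = (List.ofFn (G.eval n g v)).take i))

/-- The probability that the collision finder, on input `(x, g, i)`, outputs a preimage of `y`. -/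
def hitProb (x y : BitStr n) (g : G.keys n) (i : ℕ) : ℝ≥0∞ :=
  (pa.run [List.ofFn x, g.1, List.replicate i true] TA).toOuterMeasure
    {c | ∃ x', fn x' = y ∧ c.2 0 = List.ofFn x'}

open Classical in
/-- The success probability of the inverter for given `x` and `i`. -/
def hitValue (x y : BitStr n) (i : ℕ) : ℝ≥0∞ :=
  if fn x = y then 1 else ∑ g : G.keys n, if PrefixEq G i g (fn x) y then
    2 ^ i / (Fintype.card (G.keys n) : ℝ≥0∞) * hitProb G fn pa TA x y g i else 0

open Classical in
/-- The success probability of the inverter for given `x`, `i` and hash values `v`, `w`. -/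
def endValue (x y : BitStr n) (i : ℕ) (v w : List Bool) : ℝ≥0∞ :=
  if fn x = y then 1 else ∑ g : G.keys n,
    if List.ofFn (G.eval n g (fn x)) = v ∧ List.ofFn (G.eval n g y) = w then
    4 ^ n / (Fintype.card (G.keys n) : ℝ≥0∞) * hitProb G fn pa TA x y g i else 0

/-- Drawing a common prefix of i bits and two independent suffixes of m bits, then a g with these
two values, reaches each g with `PrefixEq` through exactly one draw. Its weight is 2^(-i) 4^(-m) ·
4^n/|G| = 2^i/|G|. -/
theorem hitValue_le (x y : BitStr n) {i m : ℕ} (him : i + m = n) :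
    hitValue G fn pa TA x y i ≤ ∑ p : BitStr m × BitStr m,
      (Fintype.card (BitStr m × BitStr m) : ℝ≥0∞)⁻¹ * ∑ c : BitStr i,
        (Fintype.card (BitStr i) : ℝ≥0∞)⁻¹ * endValue G fn pa TA x y i
          (List.ofFn c ++ List.ofFn p.1) (List.ofFn c ++ List.ofFn p.2) := by
  classical
  have hcards : (Fintype.card (BitStr m × BitStr m) : ℝ≥0∞)⁻¹ * (Fintype.card (BitStr i) : ℝ≥0∞)⁻¹
      * 4 ^ n = 2 ^ i := by
    have e : (4 : ℝ≥0∞) ^ n = (Fintype.card (BitStr m × BitStr m) * Fintype.card (BitStr i) : ℕ)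
        * 2 ^ i := by
      simp only [Fintype.card_prod, Fintype.card_fun, Fintype.card_bool, Fintype.card_fin]
      push_cast
      rw [← him, show (4 : ℝ≥0∞) = 2 ^ 2 by norm_num, ← pow_mul, ← pow_add, ← pow_add, ← pow_add]
      congr 1
      ring
    rw [e, ← mul_assoc, ← ENNReal.mul_inv (.inr (ENNReal.natCast_ne_top _)) (.inl (ENNReal.natCast_ne_top _)), ← Nat.cast_mul,
      ENNReal.inv_mul_cancel (by simp) (ENNReal.natCast_ne_top _), one_mul]
  by_cases hxy : fn x = y
  · simp only [hitValue, endValue, if_pos hxy, mul_one, Finset.sum_const, Finset.card_univ,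
      nsmul_eq_mul]
    rw [ENNReal.mul_inv_cancel (by simp) (ENNReal.natCast_ne_top _), mul_one,
      ENNReal.mul_inv_cancel (by simp) (ENNReal.natCast_ne_top _)]
  · simp only [hitValue, endValue, if_neg hxy]
    simp only [Finset.mul_sum]
    rw [← Fintype.sum_prod_type' (f := fun (p : BitStr m × BitStr m) (c : BitStr i) => _),
      Finset.sum_comm]
    refine Finset.sum_le_sum fun g _ => ?_
    by_cases hg : PrefixEq G i g (fn x) y
    · rw [if_pos hg]
      set V := List.ofFn (G.eval n g (fn x)) with hV
      set W := List.ofFn (G.eval n g y) with hW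
      obtain ⟨c, hc⟩ := exists_ofFn_eq (n := i) (V.take i) (by simp [hV]; omega)
      obtain ⟨a, ha⟩ := exists_ofFn_eq (n := m) (V.drop i) (by simp [hV]; omega)
      obtain ⟨b, hb⟩ := exists_ofFn_eq (n := m) (W.drop i) (by simp [hW]; omega)
      -- For this g only the draw read off from its own two values is kept.
      refine le_trans (le_of_eq ?_) (Finset.single_le_sum (fun _ _ => zero_le)
        (Finset.mem_univ (((a, b), c) : (BitStr m × BitStr m) × BitStr i)))
      have h1 : V = List.ofFn c ++ List.ofFn a := by rw [hc, ha, List.take_append_drop]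
      have h2 : W = List.ofFn c ++ List.ofFn b := by
        rw [hc, hb, show V.take i = W.take i from hg, List.take_append_drop]
      simp only
      rw [if_pos ⟨h1, h2⟩, ← mul_assoc, ← mul_assoc, ← hcards]
      simp only [div_eq_mul_inv]
      ring
    · rw [if_neg hg]
      exact zero_le

variable {G fn pa TA}
variable {pf pc : Prog} {TF TC : ℕ}
  (hf : ∀ x : BitStr n, pf.HaltsWithin [List.ofFn x] TF)
  (hfo : ∀ x, pf.AlwaysOutputs [List.ofFn x] fun s => Holds s [List.ofFn (fn x)])
  (hc : ∀ c : TwoPoint n, pc.HaltsWithin c.enc TC)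
  (hout : ∀ (c : TwoPoint n) (g : G.keys n), G.Fits c g →
    pc.outProb c.enc (fun s => Holds s [g.1]) = 1 / (Nat.card {g' : G.keys n // G.Fits c g'} : ℝ))
  (hcard : ∀ c : TwoPoint n, Nat.card {g' : G.keys n // G.Fits c g'} * 4 ^ n
    = Fintype.card (G.keys n))
  (ha : ∀ (x : BitStr n) (g : G.keys n) (i : ℕ), 1 ≤ i → i ≤ n →
    pa.HaltsWithin [List.ofFn x, g.1, List.replicate i true] TA)

include hf hfo hc hout hcard ha

theorem finish_wins_endValue (x y : BitStr n) {i : ℕ} (hi1 : 1 ≤ i) (hin : i ≤ n)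
    (v w : List Bool) (hv : v.length = n) (hw : w.length = n)
    (σ : Regs) (hx : σ.x = List.ofFn x) (hfx : σ.fx = List.ofFn x) (hi : σ.i = List.replicate i true)
    (h4 : σ.g = []) (h6 : σ.v = v) (h10 : σ.y = []) (h14 : σ.w = w)
    (hyr : σ.yr = (List.ofFn y).reverse) (ht : σ.t = []) (hflag : σ.flag = []) :
    Wins (finish pf pc pa) (σ.over fun _ => []) (TF + TC + TA + 60 * n + 10)
      {s | ∃ x', fn x' = y ∧ s 0 = List.ofFn x'} (endValue G fn pa TA x y i v w) := by
  classical
  obtain ⟨v, rfl⟩ := exists_ofFn_eq v hv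
  obtain ⟨w, rfl⟩ := exists_ofFn_eq w hw
  refine finish_wins (fn := fn) x y v w (hf x) (hfo x) (List.replicate i true)
    (fun l => ∃ x', fn x' = y ∧ l = List.ofFn x') _ (fun h => ⟨⟨x, h, rfl⟩, ?_⟩) σ hx hfx hi h4 h6 h10
    h14 hyr ht hflag ?_
  · rw [endValue, if_pos h]
  · intro hxy σ b hb hx hi h4 h6 h10 h14
    let c : TwoPoint n := ⟨fn x, v, y, w, hxy⟩
    have hne : Nat.card {g' : G.keys n // G.Fits c g'} ≠ 0 := by
      intro h
      have h1 := hcard c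
      have : Nonempty (G.keys n) := (G.keys_nonempty n).to_subtype
      rw [h, zero_mul] at h1
      exact Fintype.card_ne_zero h1.symm
    have hfit : ∃ g, G.Fits c g := by
      by_contra hno
      push Not at hno
      have : IsEmpty {g' : G.keys n // G.Fits c g'} := ⟨fun g => hno g.1 g.2⟩
      exact hne Nat.card_of_isEmpty
    refine (attack_wins c (hc c) (hout c) hfit (List.ofFn x) (List.replicate i true)
      (fun g => ha x g i hi1 hin) (fun l => ∃ x', fn x' = y ∧ l = List.ofFn x') σ b hb hx hi h4 h6
      h10 h14).mono le_rfl (le_of_eq ?_)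
    rw [endValue, if_neg hxy]
    refine Finset.sum_congr rfl fun g _ => ?_
    have e : G.Fits c g ↔ (List.ofFn (G.eval n g (fn x)) = List.ofFn v ∧
        List.ofFn (G.eval n g y) = List.ofFn w) := by
      rw [List.ofFn_injective.eq_iff, List.ofFn_injective.eq_iff]
      rfl
    simp only [e]
    refine if_congr Iff.rfl ?_ rfl
    rw [← hcard c, Nat.cast_mul, hitProb, div_eq_mul_inv, ENNReal.mul_inv (by simp) (by simp)]
    push_cast
    rw [mul_comm (4 ^ n : ℝ≥0∞), mul_assoc _ _ (4 ^ n : ℝ≥0∞), ENNReal.inv_mul_cancel (by simp) (by simp),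
      mul_one]

/-- The top of a stack is the first bit, so the suffixes are pushed before the common prefix. -/
theorem sample_wins (x y : BitStr n) {i : ℕ} (hi1 : 1 ≤ i) (hin : i ≤ n) :
    Wins (.seq sampleSuffix (.seq samplePrefix (finish pf pc pa)))
      ((({ x := List.ofFn x, fx := List.ofFn x, yr := (List.ofFn y).reverse } : Regs).halving
        0 0 i (n - i) []).over fun _ => [])
      (TF + TC + TA + 100 * n + 20)
      {s | ∃ x', fn x' = y ∧ s 0 = List.ofFn x'} (hitValue G fn pa TA x y i) := by
  have hle := hitValue_le G fn pa TA x y (i := i) (m := n - i) (by omega)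
  have h1 := sampleSuffix_runs { x := List.ofFn x, fx := List.ofFn x, yr := (List.ofFn y).reverse,
                                 i := List.replicate i true, i2 := List.replicate i true }
    (fun _ => []) (n - i)
  have e1 : (PMF.uniformOfFintype (BitStr (n - i))).bind (fun a =>
      (PMF.uniformOfFintype (BitStr (n - i))).map fun b =>
        ({ x := List.ofFn x, fx := List.ofFn x, yr := (List.ofFn y).reverse,
           i := List.replicate i true, i2 := List.replicate i true,
           v := List.ofFn a, w := List.ofFn b } : Regs).over fun _ => [])
      = (PMF.uniformOfFintype (BitStr (n - i) × BitStr (n - i))).map fun p =>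
        ({ x := List.ofFn x, fx := List.ofFn x, yr := (List.ofFn y).reverse,
           i := List.replicate i true, i2 := List.replicate i true,
           v := List.ofFn p.1, w := List.ofFn p.2 } : Regs).over fun _ => [] := by
    rw [← uniformOfFintype_bind_map_equiv (Equiv.refl (BitStr (n - i) × BitStr (n - i))),
      PMF.map_bind]
    simp only [PMF.map_comp]
    rfl
  simp only at h1
  rw [e1] at h1
  have h2 := fun p : BitStr (n - i) × BitStr (n - i) => samplePrefix_runs
    { x := List.ofFn x, fx := List.ofFn x, yr := (List.ofFn y).reverse,
      i := List.replicate i true } (fun _ => []) i (List.ofFn p.1) (List.ofFn p.2)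
  refine Wins.mono (Wins.seq (E := {s | ∃ x', fn x' = y ∧ s 0 = List.ofFn x'})
    (T' := TF + TC + TA + 80 * n + 13) h1 fun p _ =>
    Wins.mono (Wins.seq (h2 p) fun c _ => finish_wins_endValue hf hfo hc hout hcard ha x y hi1 hin
      (List.ofFn c ++ List.ofFn p.1) (List.ofFn c ++ List.ofFn p.2) ?_ ?_ _ rfl rfl rfl rfl rfl rfl
      rfl rfl rfl rfl) ?_ le_rfl) ?_ ?_
  · simp; omega
  · simp; omega
  · omega
  · omega
  · refine hle.trans (le_of_eq ?_)
    rw [tsum_fintype]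
    refine Finset.sum_congr rfl fun p _ => ?_
    rw [PMF.uniformOfFintype_apply, tsum_fintype]
    simp only [PMF.uniformOfFintype_apply]

theorem inverter_wins (hn : 2 ≤ n) (y : BitStr n) :
    Wins (inverter pf pc pa) (initStore [List.ofFn y]) (TF + TC + TA + 300 * n + 100)
      {s | ∃ x', fn x' = y ∧ s 0 = List.ofFn x'}
      (∑ x : BitStr n, (2 ^ n : ℝ≥0∞)⁻¹ * ∑ k ∈ Finset.range n,
        ((2 * n : ℕ) : ℝ≥0∞)⁻¹ * hitValue G fn pa TA x y (k + 1)) := by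
  have h0 : initStore [List.ofFn y] = (({ x := List.ofFn y } : Regs).over fun _ => []) := by
    funext r
    unfold Regs.over
    split <;> first | rfl | skip
    rename_i h _ _ _ _ _ _ _ _ _ _ _ _ _ _
    rcases r with _ | r
    · exact absurd rfl h
    · simp [initStore]
  have hread := readInput_runs (List.ofFn y) (fun _ => []) [] []
  simp only [List.append_nil, List.length_ofFn] at hread
  rw [h0]
  -- The prefix length is 1 + k with k drawn by `pick (n - 1)`, so one token is removed from the
  -- counter beforehand.
  refine Wins.mono (Wins.seq_pure hread (Wins.seq_pure (Runs.pop 7 _)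
    (Wins.branch_cons (T := TF + TC + TA + 250 * n + 70) ?_ ?_))) ?_ le_rfl
  · obtain ⟨m, rfl⟩ : ∃ m, n = m + 2 := ⟨n - 2, by omega⟩
    simp [List.replicate_succ]
  · have e0 : ∀ (b : Store), Function.update ((({
          yr := (List.ofFn y).reverse, u := List.replicate n true,
          rest := List.replicate n true, tok := List.replicate n true } : Regs).over b)) 7
          ((({
          yr := (List.ofFn y).reverse, u := List.replicate n true,
          rest := List.replicate n true, tok := List.replicate n true } : Regs).over b) 7).tail
        = ({
          yr := (List.ofFn y).reverse, u := List.replicate (n - 1) true,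
          rest := List.replicate n true, tok := List.replicate n true } : Regs).over b := by
      intro b
      simp
    rw [e0]
    have hsi := sampleInput_runs ({
          yr := (List.ofFn y).reverse, u := List.replicate (n - 1) true,
          rest := List.replicate n true } : Regs) (fun _ => []) n
    refine Wins.mono (Wins.seq hsi (T' := TF + TC + TA + 220 * n + 60)
      (a := fun x => ∑ k ∈ Finset.range n,
        ((2 * n : ℕ) : ℝ≥0∞)⁻¹ * hitValue G fn pa TA x y (k + 1)) fun x _ => ?_) (by omega) ?_
    · have hst := (Prog.Straight.runs_of_exec (T := 5)
        (p := .seq (.push 8 true) (.seq (.push 15 true) (.pop 11)))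
        (s := ({
          x := List.ofFn x, fx := List.ofFn x, yr := (List.ofFn y).reverse,
          u := List.replicate (n - 1) true, rest := List.replicate n true } : Regs).over fun _ => [])
        (s' := (({ x := List.ofFn x, fx := List.ofFn x, yr := (List.ofFn y).reverse } :
            Regs).halving (n - 1) 0 1 (n - 1) []).over fun _ => [])
        (by simp [Prog.Straight]) (by simp [Prog.exec, Regs.halving]) (by decide))
      have hlen := sampleLength_runs ({
        x := List.ofFn x, fx := List.ofFn x, yr := (List.ofFn y).reverse } : Regs)
        (fun _ => []) (n - 1) 1 (n - 1)
      refine Wins.mono (Wins.seq_pure hst (T' := TF + TC + TA + 200 * n + 30)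
        (Wins.mono (Wins.seq hlen (T' := TF + TC + TA + 100 * n + 20)
          (a := fun k => hitValue G fn pa TA x y (k + 1)) fun k hk => ?_) (by omega) le_rfl))
        (by omega) ?_
      · have hk' := pick_support _ _ hk
        have := sample_wins hf hfo hc hout hcard ha x y (i := k + 1) (by omega) (by omega)
        rw [show n - (k + 1) = n - 1 - k by omega, show k + 1 = 1 + k by omega] at this
        rw [show k + 1 = 1 + k by omega]
        exact this
      · refine le_trans (Finset.sum_le_sum fun k hk => mul_le_mul_left ?_ _)
          (ENNReal.sum_le_tsum (Finset.range n))
        have := le_pick (n - 1) k (by have := Finset.mem_range.1 hk; omega)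
        rwa [show 2 * (n - 1) + 2 = 2 * n by omega] at this
    · rw [tsum_fintype]
      refine le_of_eq (Finset.sum_congr rfl fun x _ => ?_)
      rw [PMF.uniformOfFintype_apply]
      congr 2
      simp
  · omega

end

/-- For n ≤ 1 there are no three distinct points, so the counts of fitting hash functions are not
available. The inverter gives up on such inputs, and only its halting is needed. -/
theorem inverter_runs_of_le_one {n : ℕ} (hn : n ≤ 1) (pf pc pa : Prog) (y : BitStr n) :
    ∃ μ, Runs (inverter pf pc pa) (initStore [List.ofFn y]) 100 μ := by
  have h0 : initStore [List.ofFn y] = (({ x := List.ofFn y } : Regs).over fun _ => []) := by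
    funext r
    unfold Regs.over
    split <;> first | rfl | skip
    rename_i h _ _ _ _ _ _ _ _ _ _ _ _ _ _
    rcases r with _ | r
    · exact absurd rfl h
    · simp [initStore]
  have hread := readInput_runs (List.ofFn y) (fun _ => []) [] []
  simp only [List.append_nil, List.length_ofFn] at hread
  rw [h0]
  refine ⟨_, (hread.seq_pure ((Runs.pop 7 _).seq_pure (Runs.branch_nil ?_ (.skip _)))).mono (by omega)⟩
  have : n - 1 = 0 := by omega
  simp [this]

/-! ### Counting hash functions -/

theorem card_prefix_eq {n : ℕ} (i : ℕ) (hi : i ≤ n) (a : BitStr n) :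
    (Finset.univ.filter fun b : BitStr n => (List.ofFn a).take i = (List.ofFn b).take i).card
      = 2 ^ (n - i) := by
  have e : (Finset.univ.filter fun b : BitStr n => (List.ofFn a).take i = (List.ofFn b).take i)
      = Fintype.piFinset fun j : Fin n => if (j : ℕ) < i then {a j} else Finset.univ := by
    ext b
    simp only [Finset.mem_filter, Finset.mem_univ, true_and, Fintype.mem_piFinset]
    constructor
    · intro h j
      by_cases hj : (j : ℕ) < i
      · rw [if_pos hj, Finset.mem_singleton]
        have := congrArg (fun l => l[(j : ℕ)]?) h
        simp only [List.getElem?_take_of_lt hj] at this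
        simpa using this.symm
      · rw [if_neg hj]; exact Finset.mem_univ _
    · intro h
      apply List.ext_getElem (by simp)
      intro k h1 h2
      have hk : k < i ∧ k < n := by simpa using h1
      have := h ⟨k, hk.2⟩
      rw [if_pos hk.1, Finset.mem_singleton] at this
      simp [this]
  rw [e, Fintype.card_piFinset]
  have : ∀ j : Fin n, (if (j : ℕ) < i then ({a j} : Finset Bool) else Finset.univ).card
      = if (j : ℕ) < i then 1 else 2 := by
    intro j; split_ifs <;> simp
  simp_rw [this]
  rw [Finset.prod_ite, Finset.prod_const_one, one_mul, Finset.prod_const]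
  congr 1
  have h1 : (Finset.univ.filter fun j : Fin n => (j : ℕ) < i).card = i := by
    rw [Fin.card_filter_val_lt]; omega
  have h2 := Finset.card_filter_add_card_filter_not (s := (Finset.univ : Finset (Fin n)))
    (fun j : Fin n => (j : ℕ) < i)
  rw [h1, Finset.card_univ, Fintype.card_fin] at h2
  omega

section
variable {G : HashFamily} {n : ℕ}

theorem HashFamily.WiseIndependent.card_eq (hG : G.WiseIndependent 3) {x y z : BitStr n}
    (hxy : x ≠ y) (hxz : x ≠ z) (hyz : y ≠ z) (a b c : BitStr n) :
    (Finset.univ.filter fun g : G.keys n =>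
        G.eval n g x = a ∧ G.eval n g y = b ∧ G.eval n g z = c).card * 8 ^ n
      = Fintype.card (G.keys n) := by
  have hinj : Function.Injective ![x, y, z] := by
    intro i j h
    fin_cases i <;> fin_cases j <;> simp_all
  obtain ⟨h1, h2⟩ := hG n ![x, y, z] hinj
  have h := h2 ![a, b, c]
  simp only [h1, Finset.prod_const, Finset.card_univ, Fintype.card_fin] at h
  have hne : (Fintype.card (G.keys n) : ℝ) ≠ 0 := by
    have : Nonempty (G.keys n) := (G.keys_nonempty n).to_subtype
    exact_mod_cast Fintype.card_ne_zero
  rw [prob, div_eq_iff hne] at h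
  have h' : ((Finset.univ.filter fun g : G.keys n =>
      G.eval n g x = a ∧ G.eval n g y = b ∧ G.eval n g z = c).card : ℝ)
      = (1 / 2 ^ n) ^ 3 * Fintype.card (G.keys n) := by
    rw [← h]
    refine congrArg _ (congrArg Finset.card ?_)
    ext g
    simp [Fin.forall_fin_succ]
  have h3 : ((Finset.univ.filter fun g : G.keys n =>
      G.eval n g x = a ∧ G.eval n g y = b ∧ G.eval n g z = c).card : ℝ) * 8 ^ n
      = Fintype.card (G.keys n) := by
    rw [h', show (8 : ℝ) = 2 ^ 3 by norm_num, ← pow_mul]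
    field_simp
    ring
  exact_mod_cast h3

/-- Reduces every count of hash functions to a count of value triples. The third value stays
innermost so that `card_prefix_eq` can evaluate it. -/
theorem HashFamily.WiseIndependent.card_filter (hG : G.WiseIndependent 3) {x y z : BitStr n}
    (hxy : x ≠ y) (hxz : x ≠ z) (hyz : y ≠ z) (Q : BitStr n → BitStr n → BitStr n → Prop)
    [∀ a b c, Decidable (Q a b c)] :
    (Finset.univ.filter fun g : G.keys n =>
        Q (G.eval n g x) (G.eval n g y) (G.eval n g z)).card * 8 ^ n
      = Fintype.card (G.keys n) * ∑ a, ∑ b, (Finset.univ.filter fun c => Q a b c).card := by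
  have h : (Finset.univ.filter fun g : G.keys n =>
        Q (G.eval n g x) (G.eval n g y) (G.eval n g z)).card
      = ∑ a, ∑ b, ∑ c, if Q a b c then (Finset.univ.filter fun g : G.keys n =>
        G.eval n g x = a ∧ G.eval n g y = b ∧ G.eval n g z = c).card else 0 := by
    have e : ∀ a b c, (if Q a b c then (Finset.univ.filter fun g : G.keys n =>
        G.eval n g x = a ∧ G.eval n g y = b ∧ G.eval n g z = c).card else 0)
        = ∑ g : G.keys n, if Q a b c ∧ G.eval n g x = a ∧ G.eval n g y = b ∧ G.eval n g z = c
          then 1 else 0 := by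
      intro a b c
      rw [Finset.card_filter]
      by_cases hq : Q a b c <;> simp [hq]
    simp_rw [e, Finset.card_filter]
    simp_rw [Finset.sum_comm (t := (Finset.univ : Finset (G.keys n)))]
    refine Finset.sum_congr rfl fun g _ => ?_
    rw [Finset.sum_eq_single (G.eval n g x), Finset.sum_eq_single (G.eval n g y),
      Finset.sum_eq_single (G.eval n g z)]
    all_goals aesop
  rw [h]
  simp_rw [Finset.sum_mul, ite_mul, hG.card_eq hxy hxz hyz, zero_mul, Finset.mul_sum,
    Finset.card_filter, Finset.mul_sum, mul_ite, mul_one, mul_zero]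

/-- Three-wise independence speaks only of three distinct points; an auxiliary third point yields
its pairwise consequences. -/
theorem exists_third (hn : 2 ≤ n) (x y : BitStr n) : ∃ z, x ≠ z ∧ y ≠ z := by
  by_contra h
  push Not at h
  have hsub : (Finset.univ : Finset (BitStr n)) ⊆ {x, y} := by
    intro z _
    by_cases hz : x = z
    · simp [hz]
    · simp [h z hz]
  have h1 := Finset.card_le_card hsub
  have h2 : ({x, y} : Finset (BitStr n)).card ≤ 2 := Finset.card_le_two
  rw [Finset.card_univ, Fintype.card_fun, Fintype.card_bool, Fintype.card_fin] at h1
  have h3 : 2 ^ 2 ≤ 2 ^ n := Nat.pow_le_pow_right (by norm_num) hn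
  omega

theorem card_fits (hG : G.WiseIndependent 3) (hn : 2 ≤ n) (c : TwoPoint n) :
    Nat.card {g' : G.keys n // G.Fits c g'} * 4 ^ n = Fintype.card (G.keys n) := by
  obtain ⟨z, h1, h2⟩ := exists_third hn c.x₁ c.x₂
  have h := hG.card_filter c.ne h1 h2 fun a b _ => a = c.y₁ ∧ b = c.y₂
  have e : ∑ a : BitStr n, ∑ b : BitStr n,
      (Finset.univ.filter fun _ : BitStr n => a = c.y₁ ∧ b = c.y₂).card = 2 ^ n := by
    rw [Finset.sum_eq_single c.y₁, Finset.sum_eq_single c.y₂]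
    · simp
    all_goals aesop
  rw [e] at h
  have hN : Nat.card {g' : G.keys n // G.Fits c g'} = (Finset.univ.filter fun g : G.keys n =>
      G.eval n g c.x₁ = c.y₁ ∧ G.eval n g c.x₂ = c.y₂).card := by
    rw [← Fintype.card_subtype, ← Nat.card_eq_fintype_card]
    rfl
  rw [hN]
  have e8 : (8 : ℕ) ^ n = 4 ^ n * 2 ^ n := by rw [← mul_pow]; norm_num
  rw [e8, ← mul_assoc] at h
  exact Nat.eq_of_mul_eq_mul_right (by positivity) h

theorem card_prefixEq (hG : G.WiseIndependent 3) (hn : 2 ≤ n) {i : ℕ} (hi : i ≤ n)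
    {u v : BitStr n} (huv : u ≠ v) :
    (Finset.univ.filter fun g => PrefixEq G i g u v).card * 2 ^ i = Fintype.card (G.keys n) := by
  obtain ⟨z, h1, h2⟩ := exists_third hn v u
  have h := hG.card_filter h2 huv h1.symm fun a _ b =>
    (List.ofFn a).take i = (List.ofFn b).take i
  simp only [card_prefix_eq i hi, Finset.sum_const, Finset.card_univ, Fintype.card_fun,
    Fintype.card_bool, Fintype.card_fin, smul_eq_mul] at h
  have e8 : (8 : ℕ) ^ n = 2 ^ i * (2 ^ n * (2 ^ n * 2 ^ (n - i))) := by
    rw [show (8 : ℕ) = 2 ^ 3 by norm_num, ← pow_mul, ← pow_add, ← pow_add, ← pow_add]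
    congr 1; omega
  rw [e8, ← mul_assoc] at h
  exact Nat.eq_of_mul_eq_mul_right (by positivity) h

/-- Collisions of u with v and with w are independent events, each of probability 2^(-i). This is
where independence of three values is essential. -/
theorem card_prefixEq_two (hG : G.WiseIndependent 3) {i : ℕ} (hi : i ≤ n)
    {u v w : BitStr n} (huv : u ≠ v) (huw : u ≠ w) (hvw : v ≠ w) :
    (Finset.univ.filter fun g => PrefixEq G i g u v ∧ PrefixEq G i g u w).card * 4 ^ i
      = Fintype.card (G.keys n) := by
  have h := hG.card_filter huv huw hvw fun a b c =>
    (List.ofFn a).take i = (List.ofFn b).take i ∧ (List.ofFn a).take i = (List.ofFn c).take i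
  have e : ∀ a b : BitStr n, (Finset.univ.filter fun c : BitStr n =>
      (List.ofFn a).take i = (List.ofFn b).take i ∧ (List.ofFn a).take i = (List.ofFn c).take i).card
      = if (List.ofFn a).take i = (List.ofFn b).take i then 2 ^ (n - i) else 0 := by
    intro a b
    by_cases hab : (List.ofFn a).take i = (List.ofFn b).take i
    · simp only [hab, true_and, if_true]
      exact card_prefix_eq i hi b
    · simp [hab]
  simp only [e, ← Finset.sum_filter, card_prefix_eq i hi, Finset.sum_const, Finset.card_univ,
    Fintype.card_fun, Fintype.card_bool, Fintype.card_fin, smul_eq_mul] at h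
  have e8 : (8 : ℕ) ^ n = 4 ^ i * (2 ^ n * (2 ^ (n - i) * 2 ^ (n - i))) := by
    rw [show (8 : ℕ) = 2 ^ 3 by norm_num, show (4 : ℕ) = 2 ^ 2 by norm_num, ← pow_mul, ← pow_mul,
      ← pow_add, ← pow_add, ← pow_add]
    congr 1; omega
  rw [e8, ← mul_assoc] at h
  exact Nat.eq_of_mul_eq_mul_right (by positivity) h

end

/-! ### Conditional entropy and subsets of the preimages -/

section
variable {Ω α : Type} [Fintype Ω] [Nonempty Ω]

open Classical in
theorem condEntropy_self (F : Ω → α) : condEntropy (fun z => z) F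
    = 𝔼 z, Real.logb 2 ((Finset.univ.filter fun z' => F z' = F z).card : ℝ) := by
  unfold condEntropy
  refine Finset.expect_congr rfl fun z _ => ?_
  congr 1
  have e : (Finset.univ.filter fun z' : Ω => z' = z ∧ F z' = F z) = {z} := by
    ext z'
    simp only [Finset.mem_filter, Finset.mem_univ, true_and, Finset.mem_singleton]
    exact ⟨fun h => h.1, fun h => ⟨h, by rw [h]⟩⟩
  have hΩ : (Fintype.card Ω : ℝ) ≠ 0 := by exact_mod_cast Fintype.card_ne_zero
  have hc : ((Finset.univ.filter fun z' => F z' = F z).card : ℝ) ≠ 0 := by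
    have : (Finset.univ.filter fun z' => F z' = F z).card ≠ 0 :=
      Finset.card_ne_zero_of_mem (Finset.mem_filter.2 ⟨Finset.mem_univ z, rfl⟩)
    exact_mod_cast this
  simp only [condProb, prob, e, Finset.card_singleton, Nat.cast_one]
  field_simp

/-- From ln t ≤ t - 1 at t = a/b; since t - 1 ≤ 0 and ln 2 ≤ 1, passing to base two preserves the
bound. -/
theorem logb_two_le {a b : ℝ} (ha : 0 < a) (hab : a ≤ b) :
    Real.logb 2 a ≤ Real.logb 2 b - (b - a) / b := by
  have hb : 0 < b := ha.trans_le hab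
  have h1 : Real.log (a / b) ≤ a / b - 1 := Real.log_le_sub_one_of_pos (div_pos ha hb)
  have h2 : a / b - 1 ≤ 0 := by rw [sub_nonpos, div_le_one hb]; exact hab
  have h3 : Real.logb 2 a - Real.logb 2 b = Real.log (a / b) / Real.log 2 := by
    rw [Real.log_div ha.ne' hb.ne', Real.logb, Real.logb, sub_div]
  have h4 : 0 < Real.log 2 := Real.log_pos (by norm_num)
  have h5 : Real.log 2 ≤ 1 := by
    have := Real.log_le_sub_one_of_pos (show (0 : ℝ) < 2 by norm_num); linarith
  have h6 : Real.log (a / b) / Real.log 2 ≤ a / b - 1 := by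
    rw [div_le_iff₀ h4]
    nlinarith
  have h7 : (b - a) / b = 1 - a / b := by field_simp
  rw [h7]
  linarith

open Classical in
/-- If `L z` omits from the preimages of `F z` those `z'` that are `bad` relative to `z`, then the
expected log-size of `L z` is smaller than the conditional entropy by at least the probability that
a random preimage is bad. The roles of `z` and `z'` are exchangeable. -/
theorem expect_logb_card_le (F : Ω → α) (bad : Ω → Ω → Prop) (hbad : ∀ z, ¬ bad z z) :
    𝔼 z, Real.logb 2 ((Finset.univ.filter fun z' => F z' = F z ∧ ¬ bad z z').card : ℝ)
      ≤ condEntropy (fun z => z) F - 𝔼 z,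
        ((Finset.univ.filter fun z' => F z' = F z ∧ bad z' z).card : ℝ) /
          (Finset.univ.filter fun z' => F z' = F z).card := by
  have hswap : 𝔼 z, ((Finset.univ.filter fun z' => F z' = F z ∧ bad z' z).card : ℝ) /
          (Finset.univ.filter fun z' => F z' = F z).card
      = 𝔼 z, ((Finset.univ.filter fun z' => F z' = F z ∧ bad z z').card : ℝ) /
          (Finset.univ.filter fun z' => F z' = F z).card := by
    simp only [Finset.card_filter, Nat.cast_sum, Nat.cast_ite, Nat.cast_one, Nat.cast_zero,
      Finset.sum_div]
    -- Both sides sum over ordered pairs in a common fiber, with a weight that depends on the fiber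
    -- alone.
    rw [Fintype.expect_eq_sum_div_card, Fintype.expect_eq_sum_div_card, Finset.sum_comm]
    congr 1
    refine Finset.sum_congr rfl fun z _ => Finset.sum_congr rfl fun z' _ => ?_
    by_cases h : F z = F z'
    · simp [h]
    · simp [h, Ne.symm h]
  rw [hswap, condEntropy_self, ← Finset.expect_sub_distrib]
  refine Finset.expect_le_expect fun z _ => ?_
  have hsplit := Finset.card_filter_add_card_filter_not
    (s := Finset.univ.filter fun z' => F z' = F z) (bad z)
  rw [Finset.filter_filter, Finset.filter_filter] at hsplit
  have hpos : 0 < (Finset.univ.filter fun z' => F z' = F z ∧ ¬ bad z z').card :=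
    Finset.card_pos.2 ⟨z, by simp [hbad]⟩
  have h := logb_two_le (a := ((Finset.univ.filter fun z' => F z' = F z ∧ ¬ bad z z').card : ℝ))
    (b := (Finset.univ.filter fun z' => F z' = F z).card) (by exact_mod_cast hpos)
    (by exact_mod_cast (by omega))
  have e : ((Finset.univ.filter fun z' => F z' = F z).card : ℝ)
      - (Finset.univ.filter fun z' => F z' = F z ∧ ¬ bad z z').card
      = (Finset.univ.filter fun z' => F z' = F z ∧ bad z z').card := by
    rw [← hsplit]; push_cast; ring
  rwa [e] at h

end

/-! ### The entropy gap -/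

section
variable {n : ℕ}

/-- The number of preimages of `y`. -/
def fiber (fn : BitStr n → BitStr n) (y : BitStr n) : ℕ :=
  (Finset.univ.filter fun x => fn x = y).card

theorem fiber_pos (fn : BitStr n → BitStr n) (x : BitStr n) : 0 < fiber fn (fn x) :=
  Finset.card_pos.2 ⟨x, by simp⟩

theorem card_bitStr (n : ℕ) : Fintype.card (BitStr n) = 2 ^ n := by simp

/-- A pointwise form of Chebyshev's inequality: if N < μ/2 the quadratic term is at least 1 and the
bound is trivial, otherwise M/(N' + M) ≤ 2M/μ. Averaging it needs only a second moment of N. -/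
theorem ratio_lower_bound {N N' μ M : ℝ} (hN : 0 ≤ N) (hNN : N ≤ N') (hμ : 0 < μ) (hM : 0 < M) :
    1 - (4 * (N - μ) ^ 2 / μ ^ 2 + 2 * M / μ) ≤ N' / (N' + M) := by
  have h0 : 0 ≤ 2 * M / μ := by positivity
  have h1 : 0 ≤ 4 * (N - μ) ^ 2 / μ ^ 2 := by positivity
  by_cases h : N < μ / 2
  · have h2 : 1 ≤ 4 * (N - μ) ^ 2 / μ ^ 2 := by
      rw [le_div_iff₀ (by positivity)]
      nlinarith
    have h3 : 0 ≤ N' / (N' + M) := div_nonneg (by linarith) (by linarith)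
    linarith
  · push Not at h
    have h2 : N' / (N' + M) = 1 - M / (N' + M) := by
      have : N' + M ≠ 0 := by linarith
      field_simp
      ring
    have h3 : M / (N' + M) ≤ 2 * M / μ := by
      rw [div_le_div_iff₀ (by linarith) hμ]
      nlinarith
    linarith

/-- A variance bound. Pairs in `Λ` with different images are uncorrelated; pairs with the same image
collide together, and each point has at most `fiber fn (fn x)` such partners. This is why `Λ` admits
only fibers no larger than that of `x`. -/
theorem sum_sq_sub_le {G : HashFamily} (hG : G.WiseIndependent 3) (hn : 2 ≤ n) {i : ℕ} (hi : i ≤ n)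
    (fn : BitStr n → BitStr n) (x : BitStr n) (Λ : Finset (BitStr n))
    (hΛ : ∀ x' ∈ Λ, fn x' ≠ fn x ∧ fiber fn (fn x') ≤ fiber fn (fn x)) :
    ∑ g : G.keys n, (((Λ.filter fun x' => PrefixEq G i g (fn x) (fn x')).card : ℝ)
        - (Λ.card : ℝ) / 2 ^ i) ^ 2
      ≤ (Fintype.card (G.keys n) : ℝ) * ((Λ.card : ℝ) / 2 ^ i * fiber fn (fn x)) := by
  set K : ℝ := ((Fintype.card (G.keys n) : ℕ) : ℝ) with hK
  have hone : ∀ x' ∈ Λ, (∑ g : G.keys n, if PrefixEq G i g (fn x) (fn x') then (1 : ℝ) else 0)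
      = K / 2 ^ i := by
    intro x' hx'
    have h := card_prefixEq hG hn hi (hΛ x' hx').1.symm
    rw [eq_div_iff (by positivity), ← Finset.sum_filter, Finset.sum_const, nsmul_eq_mul, mul_one,
      hK, ← h]
    push_cast
    rfl
  have htwo : ∀ x' ∈ Λ, ∀ x'' ∈ Λ, (∑ g : G.keys n,
      (if PrefixEq G i g (fn x) (fn x') then (1 : ℝ) else 0) *
        (if PrefixEq G i g (fn x) (fn x'') then (1 : ℝ) else 0))
      ≤ K / 4 ^ i + if fn x'' = fn x' then K / 2 ^ i else 0 := by
    intro x' hx' x'' hx''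
    by_cases he : fn x'' = fn x'
    · rw [if_pos he, he]
      have : ∀ g : G.keys n, (if PrefixEq G i g (fn x) (fn x') then (1 : ℝ) else 0) *
        (if PrefixEq G i g (fn x) (fn x') then (1 : ℝ) else 0) =
          if PrefixEq G i g (fn x) (fn x') then (1 : ℝ) else 0 := fun g => by split_ifs <;> simp
      simp_rw [this]
      rw [hone x' hx']
      have : 0 ≤ K / 4 ^ i := by positivity
      linarith
    · rw [if_neg he, add_zero]
      have h := card_prefixEq_two hG hi (hΛ x' hx').1.symm (hΛ x'' hx'').1.symm (Ne.symm he)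
      apply le_of_eq
      rw [eq_div_iff (by positivity), hK, ← h, Finset.card_filter]
      push_cast
      congr 1
      refine Finset.sum_congr rfl fun g _ => ?_
      by_cases h1 : PrefixEq G i g (fn x) (fn x') <;>
        by_cases h2 : PrefixEq G i g (fn x) (fn x'') <;> simp [h1, h2]
  have hcard : ∀ g : G.keys n, ((Λ.filter fun x' => PrefixEq G i g (fn x) (fn x')).card : ℝ)
      = ∑ x' ∈ Λ, if PrefixEq G i g (fn x) (fn x') then (1 : ℝ) else 0 := fun g => by
    rw [Finset.card_filter]; push_cast; rfl
  have hsum1 : ∑ g : G.keys n, ((Λ.filter fun x' => PrefixEq G i g (fn x) (fn x')).card : ℝ)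
      = Λ.card * (K / 2 ^ i) := by
    simp_rw [hcard]
    rw [Finset.sum_comm, Finset.sum_congr rfl hone, Finset.sum_const, nsmul_eq_mul]
  have hsum2 : ∑ g : G.keys n, ((Λ.filter fun x' => PrefixEq G i g (fn x) (fn x')).card : ℝ) ^ 2
      ≤ Λ.card * (Λ.card * (K / 4 ^ i) + fiber fn (fn x) * (K / 2 ^ i)) := by
    simp_rw [hcard, sq, Finset.sum_mul_sum]
    rw [Finset.sum_comm]
    rw [← nsmul_eq_mul]
    refine Finset.sum_le_card_nsmul _ _ _ fun x' hx' => ?_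
    rw [Finset.sum_comm]
    refine (Finset.sum_le_sum fun x'' hx'' => htwo x' hx' x'' hx'').trans ?_
    rw [Finset.sum_add_distrib, Finset.sum_const, nsmul_eq_mul]
    refine add_le_add_right ?_ _
    rw [← Finset.sum_filter, Finset.sum_const, nsmul_eq_mul]
    refine mul_le_mul_of_nonneg_right ?_ (by positivity)
    have h1 : (Λ.filter fun x'' => fn x'' = fn x').card ≤ fiber fn (fn x') :=
      Finset.card_le_card (Finset.filter_subset_filter _ (Finset.subset_univ _))
    exact_mod_cast h1.trans (hΛ x' hx').2
  have e : ∀ g : G.keys n, (((Λ.filter fun x' => PrefixEq G i g (fn x) (fn x')).card : ℝ)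
        - (Λ.card : ℝ) / 2 ^ i) ^ 2
      = ((Λ.filter fun x' => PrefixEq G i g (fn x) (fn x')).card : ℝ) ^ 2
        - 2 * (Λ.card / 2 ^ i) * ((Λ.filter fun x' => PrefixEq G i g (fn x) (fn x')).card : ℝ)
        + (Λ.card / 2 ^ i) ^ 2 := fun g => by ring
  simp_rw [e]
  rw [Finset.sum_add_distrib, Finset.sum_sub_distrib, ← Finset.mul_sum, hsum1, Finset.sum_const,
    Finset.card_univ, nsmul_eq_mul, ← hK]
  have h4 : (4 : ℝ) ^ i = 2 ^ i * 2 ^ i := by rw [← mul_pow]; norm_num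
  rw [h4] at hsum2
  refine (add_le_add_left (sub_le_sub_right hsum2 _) _).trans (le_of_eq ?_)
  field_simp
  ring

/-- If `2^i` is small compared with `2^n / #f⁻¹(f(x))`, and `f(x)` does not have much smaller
probability than a typical image, then among the `x'` for which `f(x)` and `f(x')` collide under a
random hash function truncated to `i` bits, a constant fraction has a different image. -/
theorem quarter_le_sum_ratio {G : HashFamily} (hG : G.WiseIndependent 3) (hn : 2 ≤ n) {i : ℕ}
    (hi : i ≤ n) (fn : BitStr n → BitStr n) (x : BitStr n)
    (h1 : 64 * 2 ^ i * fiber fn (fn x) ≤ 2 ^ n)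
    (h2 : 2 ^ n ≤ 4 * (Finset.univ.filter fun x' => fiber fn (fn x') ≤ fiber fn (fn x)).card) :
    (Fintype.card (G.keys n) : ℝ) / 4 ≤ ∑ g : G.keys n,
      ((Finset.univ.filter fun x' => PrefixEq G i g (fn x) (fn x') ∧ fn x' ≠ fn x).card : ℝ) /
        (Finset.univ.filter fun x' => PrefixEq G i g (fn x) (fn x')).card := by
  set M := fiber fn (fn x) with hM
  set Λ := Finset.univ.filter fun x' => fn x' ≠ fn x ∧ fiber fn (fn x') ≤ fiber fn (fn x) with hΛ
  have hMpos : (0 : ℝ) < M := by exact_mod_cast fiber_pos fn x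
  have hΛcard : (Finset.univ.filter fun x' => fiber fn (fn x') ≤ M).card ≤ Λ.card + M := by
    refine (Finset.card_le_card (t := Λ ∪ Finset.univ.filter fun x' => fn x' = fn x) ?_).trans
      (Finset.card_union_le _ _)
    intro x' hx'
    simp only [hΛ, Finset.mem_union, Finset.mem_filter, Finset.mem_univ, true_and] at hx' ⊢
    tauto
  set μ : ℝ := Λ.card / 2 ^ i with hμ
  have h2i : (0 : ℝ) < 2 ^ i := by positivity
  -- The hypotheses give |Λ| + M ≥ 2^n/4 ≥ 16 · 2^i M, hence |Λ| ≥ 15 · 2^i M.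
  have hμM : 8 * (M : ℝ) ≤ μ := by
    rw [hμ, le_div_iff₀ h2i]
    have e1 : (64 * 2 ^ i * M : ℝ) ≤ 2 ^ n := by exact_mod_cast h1
    have e2 : (2 ^ n : ℝ) ≤ 4 * (Λ.card + M) := by exact_mod_cast h2.trans (by omega)
    have e3 : (1 : ℝ) ≤ 2 ^ i := one_le_pow₀ (by norm_num)
    nlinarith
  have hμpos : 0 < μ := by linarith
  have hterm : ∀ g : G.keys n,
      1 - (4 * (((Λ.filter fun x' => PrefixEq G i g (fn x) (fn x')).card : ℝ) - μ) ^ 2 / μ ^ 2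
        + 2 * M / μ) ≤
      ((Finset.univ.filter fun x' => PrefixEq G i g (fn x) (fn x') ∧ fn x' ≠ fn x).card : ℝ) /
        (Finset.univ.filter fun x' => PrefixEq G i g (fn x) (fn x')).card := by
    intro g
    have hsplit := Finset.card_filter_add_card_filter_not
      (s := Finset.univ.filter fun x' => PrefixEq G i g (fn x) (fn x')) (fun x' => fn x' ≠ fn x)
    rw [Finset.filter_filter, Finset.filter_filter] at hsplit
    have e : (Finset.univ.filter fun x' => PrefixEq G i g (fn x) (fn x') ∧ ¬ fn x' ≠ fn x)
        = Finset.univ.filter fun x' => fn x' = fn x := by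
      ext x'
      simp only [Finset.mem_filter, Finset.mem_univ, true_and, not_not]
      exact ⟨fun h => h.2, fun h => ⟨by rw [h]; rfl, h⟩⟩
    rw [e] at hsplit
    rw [← hsplit]
    push_cast
    refine ratio_lower_bound (by positivity) ?_ hμpos hMpos
    refine Nat.cast_le.2 (Finset.card_le_card fun x' hx' => ?_)
    simp only [hΛ, Finset.mem_filter, Finset.mem_univ, true_and] at hx' ⊢
    exact ⟨hx'.2, hx'.1.1⟩
  refine le_trans ?_ (Finset.sum_le_sum fun g _ => hterm g)
  rw [Finset.sum_sub_distrib, Finset.sum_add_distrib, ← Finset.sum_div, ← Finset.mul_sum]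
  simp only [Finset.sum_const, Finset.card_univ, nsmul_eq_mul, mul_one]
  have hvar := sum_sq_sub_le hG hn hi fn x Λ fun x' hx' => by
    simpa [hΛ] using hx'
  rw [← hμ, ← hM] at hvar
  have hK : (0 : ℝ) ≤ Fintype.card (G.keys n) := by positivity
  -- The variance bound makes the quadratic term at most 4M/μ ≤ 1/2 on average, and 2M/μ ≤ 1/4,
  -- which leaves 1 - 1/2 - 1/4 = 1/4.
  have b1 : 4 * (∑ g : G.keys n,
      (((Λ.filter fun x' => PrefixEq G i g (fn x) (fn x')).card : ℝ) - μ) ^ 2) / μ ^ 2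
      ≤ Fintype.card (G.keys n) / 2 := by
    rw [div_le_iff₀ (by positivity)]
    nlinarith [mul_nonneg hK hμpos.le]
  have b2 : (2 * M / μ : ℝ) ≤ 1 / 4 := by
    rw [div_le_iff₀ hμpos]; linarith
  nlinarith

/-- `2^i` is not small compared with `2^n / m`. -/
def Heavy (n c i m : ℕ) : Prop := 2 ^ n ≤ m * 2 ^ i * n ^ c

instance (n c i m : ℕ) : Decidable (Heavy n c i m) := inferInstanceAs (Decidable (_ ≤ _))

/-- With h = ⌊log(2^n/m)⌋ and ℓ = ⌊log n^c⌋, every i with h - ℓ < i ≤ h - 6 qualifies; 6 is log 64.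
The assumption `hmn` gives ℓ ≤ h, so the lower end is not truncated. -/
theorem le_card_window (c m : ℕ) (hm : 0 < m) (hmn : m * n ^ c ≤ 2 ^ n) (hn : 0 < n) :
    Nat.log 2 (n ^ c) - 6 ≤ ((Finset.Icc 1 n).filter fun i =>
      Heavy n c i m ∧ 64 * 2 ^ i * m ≤ 2 ^ n).card := by
  set ℓ := Nat.log 2 (n ^ c) with hℓ
  by_cases hl : ℓ ≤ 6
  · omega
  set h := Nat.log 2 (2 ^ n / m) with hh
  have hℓ1 : 2 ^ ℓ ≤ n ^ c := Nat.pow_log_le_self 2 (by positivity)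
  have hmle : m ≤ 2 ^ n := (Nat.le_mul_of_pos_right m (by positivity)).trans hmn
  have hq : 2 ^ n / m ≠ 0 := (Nat.div_pos hmle hm).ne'
  have h1 : 2 ^ h * m ≤ 2 ^ n := (Nat.le_div_iff_mul_le hm).1 (Nat.pow_log_le_self 2 hq)
  have h2 : 2 ^ n < 2 ^ (h + 1) * m :=
    (Nat.div_lt_iff_lt_mul hm).1 (Nat.lt_pow_succ_log_self (by norm_num) _)
  have hhl : ℓ ≤ h := Nat.le_log_of_pow_le (by norm_num)
    ((Nat.le_div_iff_mul_le hm).2 (by nlinarith))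
  have hhn : h ≤ n := by
    have : 2 ^ h ≤ 2 ^ n := (Nat.le_mul_of_pos_right _ hm).trans h1
    exact (Nat.pow_le_pow_iff_right (by norm_num)).1 this
  have hsub : Finset.Ioc (h - ℓ) (h - 6) ⊆ (Finset.Icc 1 n).filter fun i =>
      Heavy n c i m ∧ 64 * 2 ^ i * m ≤ 2 ^ n := by
    intro i hi
    rw [Finset.mem_Ioc] at hi
    rw [Finset.mem_filter, Finset.mem_Icc]
    refine ⟨⟨by omega, by omega⟩, ?_, ?_⟩
    · have e1 : 2 ^ (h + 1) ≤ 2 ^ i * 2 ^ ℓ := by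
        rw [← pow_add]; exact Nat.pow_le_pow_right (by norm_num) (by omega)
      calc 2 ^ n ≤ 2 ^ (h + 1) * m := h2.le
        _ ≤ (2 ^ i * 2 ^ ℓ) * m := Nat.mul_le_mul_right _ e1
        _ ≤ (2 ^ i * n ^ c) * m := Nat.mul_le_mul_right _ (Nat.mul_le_mul_left _ hℓ1)
        _ = m * 2 ^ i * n ^ c := by ring
    · have e1 : 64 * 2 ^ i ≤ 2 ^ h := by
        rw [show 64 = 2 ^ 6 by norm_num, ← pow_add]
        exact Nat.pow_le_pow_right (by norm_num) (by omega)
      exact (Nat.mul_le_mul_right _ e1).trans h1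
  refine le_trans ?_ (Finset.card_le_card hsub)
  rw [Nat.card_Ioc]
  omega

/-- Few points have a value of `m` below that of all but a small fraction of the points. -/
theorem card_small_rank {Ω : Type} [Fintype Ω] (m : Ω → ℕ) :
    4 * (Finset.univ.filter fun x =>
        ¬ Fintype.card Ω ≤ 4 * (Finset.univ.filter fun x' => m x' ≤ m x).card).card
      ≤ Fintype.card Ω := by
  classical
  set B := Finset.univ.filter fun x =>
    ¬ Fintype.card Ω ≤ 4 * (Finset.univ.filter fun x' => m x' ≤ m x).card with hB
  rcases B.eq_empty_or_nonempty with h | h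
  · rw [h]; simp
  · obtain ⟨x, hx, hmax⟩ := B.exists_max_image m h
    have hsub : B ⊆ Finset.univ.filter fun x' => m x' ≤ m x := fun x' hx' => by
      simpa using hmax x' hx'
    have h1 := Finset.card_le_card hsub
    have h2 := (Finset.mem_filter.1 hx).2
    omega

end

section
variable (f : ∀ n, BitStr n → BitStr n) (G : HashFamily) (c n : ℕ)

/-- `z'` differs from `z` in the value of `f`, and this value has large probability. -/
def Bad (z z' : HashDom G n) : Prop :=
  f n z.1 ≠ f n z'.1 ∧ Heavy n c z'.2.2 (fiber (f n) (f n z'.1))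

open Classical in
/-- The set of the preimages of `F(z)` that are not bad. -/
def goodSet (z : HashDom G n) : Finset (HashDom G n) :=
  Finset.univ.filter fun z' => hashPrefix f G n z' = hashPrefix f G n z ∧ ¬ Bad f G c n z z'

variable {f G c n}

theorem hashPrefix_eq_iff (z z' : HashDom G n) : hashPrefix f G n z' = hashPrefix f G n z ↔
    z'.2 = z.2 ∧ PrefixEq G z.2.2 z.2.1 (f n z.1) (f n z'.1) := by
  obtain ⟨x, g, i⟩ := z
  obtain ⟨x', g', i'⟩ := z'
  simp only [hashPrefix, Prod.mk.injEq, PrefixEq]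
  constructor
  · rintro ⟨h, rfl, rfl⟩; exact ⟨⟨rfl, rfl⟩, h.symm⟩
  · rintro ⟨⟨rfl, rfl⟩, h⟩; exact ⟨h.symm, rfl, rfl⟩

open Classical in
theorem card_preimages (z : HashDom G n) (Q : BitStr n → Prop) :
    (Finset.univ.filter fun z' : HashDom G n =>
        hashPrefix f G n z' = hashPrefix f G n z ∧ Q z'.1).card
      = (Finset.univ.filter fun x' => PrefixEq G z.2.2 z.2.1 (f n z.1) (f n x') ∧ Q x').card := by
  refine (Finset.card_bij (fun x' _ => (x', z.2)) ?_ ?_ ?_).symm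
  · intro x' hx'
    simp only [Finset.mem_filter, Finset.mem_univ, true_and, hashPrefix_eq_iff] at hx' ⊢
    exact hx'
  · intro a _ b _ h
    exact (Prod.ext_iff.1 h).1
  · intro z' hz'
    simp only [Finset.mem_filter, Finset.mem_univ, true_and, hashPrefix_eq_iff] at hz' ⊢
    exact ⟨z'.1, ⟨hz'.1.2, hz'.2⟩, Prod.ext rfl hz'.1.1.symm⟩

-- At least half of the `x`, at least ⌊log n^c⌋ - 6 of the n prefix lengths, and a fraction 1/4 on
-- average over g: the product is the gap with denominator 8n.
open Classical in
theorem entropy_gap (hG : G.WiseIndependent 3) (hn : 2 ≤ n)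
    (hlight : 4 * (Finset.univ.filter fun x => ¬ fiber (f n) (f n x) * n ^ c ≤ 2 ^ n).card ≤ 2 ^ n) :
    𝔼 z, Real.logb 2 ((goodSet f G c n z).card : ℝ)
      ≤ condEntropy (fun z : HashDom G n => z) (hashPrefix f G n)
        - ((Nat.log 2 (n ^ c) - 6 : ℕ) : ℝ) / (8 * n) := by
  have hK : Nonempty (G.keys n) := (G.keys_nonempty n).to_subtype
  have hI : Nonempty (Finset.Icc 1 n) := ⟨⟨1, Finset.mem_Icc.2 ⟨le_rfl, by omega⟩⟩⟩
  have h := expect_logb_card_le (hashPrefix f G n) (Bad f G c n) fun z h => h.1 rfl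
  refine (le_of_eq (Finset.expect_congr rfl fun z _ => ?_)).trans (h.trans (sub_le_sub_left ?_ _))
  · unfold goodSet
    congr!
  set K : ℝ := ((Fintype.card (G.keys n) : ℕ) : ℝ) with hKdef
  have hKpos : 0 < K := by rw [hKdef]; exact_mod_cast Fintype.card_pos
  set J := Nat.log 2 (n ^ c) - 6 with hJ
  set R : BitStr n → G.keys n → ℕ → ℝ := fun x g i =>
    ((Finset.univ.filter fun x' =>
      PrefixEq G i g (f n x) (f n x') ∧ f n x' ≠ f n x).card : ℝ) /
        (Finset.univ.filter fun x' => PrefixEq G i g (f n x) (f n x')).card with hR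
  have hR0 : ∀ x g i, 0 ≤ R x g i := fun x g i => by positivity
  -- After the exchange of `z` and `z'`, heaviness concerns `z` itself, so it is a condition on `x`
  -- and `i` that does not involve the colliding points.
  have hterm : ∀ z : HashDom G n,
      ((Finset.univ.filter fun z' =>
        hashPrefix f G n z' = hashPrefix f G n z ∧ Bad f G c n z' z).card : ℝ) /
        (Finset.univ.filter fun z' => hashPrefix f G n z' = hashPrefix f G n z).card
      = if Heavy n c z.2.2 (fiber (f n) (f n z.1)) then R z.1 z.2.1 z.2.2 else 0 := by
    intro z
    have e1 := card_preimages (f := f) z fun _ => True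
    have e2 := card_preimages (f := f) z fun x' => f n x' ≠ f n z.1
    simp only [and_true] at e1
    by_cases hh : Heavy n c z.2.2 (fiber (f n) (f n z.1))
    · simp only [Bad, hh, and_true, if_true, hR]
      rw [e1]
      exact congrArg₂ (· / ·) (congrArg Nat.cast (Eq.trans (by congr!) (e2.trans (by congr!))))
        (by congr!)
    · rw [if_neg hh, Finset.filter_false_of_mem fun z' _ h => hh h.2.2]
      simp
  refine le_of_le_of_eq ?_ (Finset.expect_congr rfl fun z _ => Eq.trans ?_ (hterm z)).symm
  swap
  · congr!
  rw [Fintype.expect_eq_sum_div_card, Fintype.sum_prod_type]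
  simp_rw [Fintype.sum_prod_type]
  have hsumi : ∀ x g, ∑ i : Finset.Icc 1 n,
      (if Heavy n c i.1 (fiber (f n) (f n x)) then R x g i.1 else 0)
      = ∑ i ∈ Finset.Icc 1 n, if Heavy n c i (fiber (f n) (f n x)) then R x g i else 0 :=
    fun x g => Finset.sum_coe_sort (Finset.Icc 1 n)
      (fun i => if Heavy n c i (fiber (f n) (f n x)) then R x g i else 0)
  simp_rw [hsumi]
  set good := Finset.univ.filter fun x => fiber (f n) (f n x) * n ^ c ≤ 2 ^ n ∧
    2 ^ n ≤ 4 * (Finset.univ.filter fun x' =>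
      fiber (f n) (f n x') ≤ fiber (f n) (f n x)).card with hgood
  -- Each of the two conditions fails for at most a quarter of the points.
  have hgoodcard : 2 ^ n ≤ 2 * good.card := by
    have h1 := card_small_rank fun x => fiber (f n) (f n x)
    rw [card_bitStr] at h1
    have h2 : Finset.univ ⊆ good ∪ ((Finset.univ.filter fun x =>
        ¬ fiber (f n) (f n x) * n ^ c ≤ 2 ^ n) ∪ (Finset.univ.filter fun x =>
        ¬ 2 ^ n ≤ 4 * (Finset.univ.filter fun x' =>
          fiber (f n) (f n x') ≤ fiber (f n) (f n x)).card)) := by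
      intro x _
      simp only [hgood, Finset.mem_union, Finset.mem_filter, Finset.mem_univ, true_and]
      tauto
    have h3 := (Finset.card_le_card h2).trans ((Finset.card_union_le _ _).trans
      (Nat.add_le_add_left (Finset.card_union_le _ _) _))
    rw [Finset.card_univ, card_bitStr] at h3
    omega
  have hx : ∀ x ∈ good, (J : ℝ) * (K / 4) ≤ ∑ g : G.keys n, ∑ i ∈ Finset.Icc 1 n,
      if Heavy n c i (fiber (f n) (f n x)) then R x g i else 0 := by
    intro x hx
    rw [hgood, Finset.mem_filter] at hx
    obtain ⟨-, hx1, hx2⟩ := hx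
    rw [Finset.sum_comm]
    set W := (Finset.Icc 1 n).filter fun i =>
      Heavy n c i (fiber (f n) (f n x)) ∧ 64 * 2 ^ i * fiber (f n) (f n x) ≤ 2 ^ n with hW
    have hWJ : J ≤ W.card := le_card_window c _ (fiber_pos _ x) hx1 (by omega)
    calc (J : ℝ) * (K / 4) ≤ W.card * (K / 4) :=
          mul_le_mul_of_nonneg_right (by exact_mod_cast hWJ) (by positivity)
      _ = ∑ _i ∈ W, K / 4 := by rw [Finset.sum_const, nsmul_eq_mul]
      _ ≤ ∑ i ∈ W, ∑ g : G.keys n,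
          if Heavy n c i (fiber (f n) (f n x)) then R x g i else 0 := by
        refine Finset.sum_le_sum fun i hi => ?_
        rw [hW, Finset.mem_filter, Finset.mem_Icc] at hi
        simp only [if_pos hi.2.1]
        exact quarter_le_sum_ratio hG hn hi.1.2 (f n) x hi.2.2 hx2
      _ ≤ _ := by
        refine Finset.sum_le_sum_of_subset_of_nonneg (Finset.filter_subset _ _) fun i _ _ => ?_
        refine Finset.sum_nonneg fun g _ => ?_
        split_ifs
        · exact hR0 _ _ _
        · exact le_rfl
  have hcardD : (Fintype.card (HashDom G n) : ℝ) = 2 ^ n * (K * n) := by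
    rw [Fintype.card_prod, Fintype.card_prod, card_bitStr, Fintype.card_coe (Finset.Icc 1 n),
      Nat.card_Icc]
    push_cast
    simp [hKdef]
  have hn0 : (0 : ℝ) < n := by exact_mod_cast (by omega : 0 < n)
  rw [hcardD, div_le_div_iff₀ (by positivity) (by positivity)]
  have htotal : good.card * ((J : ℝ) * (K / 4)) ≤ ∑ x, ∑ g : G.keys n, ∑ i ∈ Finset.Icc 1 n,
      if Heavy n c i (fiber (f n) (f n x)) then R x g i else 0 := by
    rw [← nsmul_eq_mul]
    refine (Finset.card_nsmul_le_sum good _ _ hx).trans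
      (Finset.sum_le_sum_of_subset_of_nonneg (Finset.subset_univ _) fun x _ _ => ?_)
    refine Finset.sum_nonneg fun g _ => Finset.sum_nonneg fun i _ => ?_
    split_ifs
    · exact hR0 _ _ _
    · exact le_rfl
  have hg : (2 ^ n : ℝ) ≤ 2 * good.card := by exact_mod_cast hgoodcard
  calc (J : ℝ) * (2 ^ n * (K * n)) ≤ J * ((2 * good.card) * (K * n)) := by gcongr
    _ = (good.card * ((J : ℝ) * (K / 4))) * (8 * n) := by ring
    _ ≤ _ := mul_le_mul_of_nonneg_right htotal (by positivity)

end

/-! ### The success probability of the inverter -/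

theorem sum_fiber_mul {n : ℕ} (fn : BitStr n → BitStr n) (φ : BitStr n → ℝ) :
    ∑ y, (fiber fn y : ℝ) * φ y = ∑ x, φ (fn x) := by
  have : ∀ y, (fiber fn y : ℝ) * φ y = ∑ x, if fn x = y then φ y else 0 := fun y => by
    rw [fiber, Finset.card_filter]
    push_cast
    rw [Finset.sum_mul]
    refine Finset.sum_congr rfl fun x _ => ?_
    split_ifs <;> simp
  simp_rw [this]
  rw [Finset.sum_comm]
  simp

theorem sum_range_succ_eq_Icc {M : Type} [AddCommMonoid M] (φ : ℕ → M) (n : ℕ) :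
    ∑ k ∈ Finset.range n, φ (k + 1) = ∑ i ∈ Finset.Icc 1 n, φ i := by
  rw [Finset.range_eq_Ico, Finset.sum_Ico_add' φ 0 n 1]
  exact Finset.sum_congr (by ext; simp) fun _ _ => rfl

section
variable {G : HashFamily} {n : ℕ} {fn : BitStr n → BitStr n} {pf pc pa : Prog} {TF TC TA : ℕ}

theorem hitProb_ne_top (x y : BitStr n) (g : G.keys n) (i : ℕ) :
    hitProb G fn pa TA x y g i ≠ ∞ := toOuterMeasure_ne_top _ _

theorem two_pow_div_card_ne_top (i : ℕ) : (2 : ℝ≥0∞) ^ i / (Fintype.card (G.keys n) : ℝ≥0∞) ≠ ∞ := by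
  have : Nonempty (G.keys n) := (G.keys_nonempty n).to_subtype
  exact ENNReal.div_ne_top (by simp) (by exact_mod_cast Fintype.card_ne_zero)

theorem hitValue_ne_top (x y : BitStr n) (i : ℕ) : hitValue G fn pa TA x y i ≠ ∞ := by
  unfold hitValue
  split_ifs
  · simp
  · refine ENNReal.sum_ne_top.2 fun g _ => ?_
    split_ifs
    · exact ENNReal.mul_ne_top (two_pow_div_card_ne_top i) (hitProb_ne_top x y g i)
    · simp

theorem toReal_hitValue (x y : BitStr n) (i : ℕ) : (hitValue G fn pa TA x y i).toReal
    = if fn x = y then 1 else ∑ g : G.keys n, if PrefixEq G i g (fn x) y then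
      2 ^ i / (Fintype.card (G.keys n) : ℝ) * (hitProb G fn pa TA x y g i).toReal else 0 := by
  unfold hitValue
  by_cases h : fn x = y
  · simp [h]
  · rw [if_neg h, if_neg h, ENNReal.toReal_sum]
    · refine Finset.sum_congr rfl fun g _ => ?_
      by_cases hg : PrefixEq G i g (fn x) y
      · simp [hg]
      · simp [hg]
    · intro g _
      split_ifs
      · exact ENNReal.mul_ne_top (two_pow_div_card_ne_top i) (hitProb_ne_top x y g i)
      · simp

/-- The sum of the success probabilities of the collision finder, weighted by `2^i`. -/
def weightedHits (G : HashFamily) {n : ℕ} (fn : BitStr n → BitStr n) (pa : Prog) (TA : ℕ)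
    (y : BitStr n) : ℝ :=
  ∑ x, ∑ i ∈ Finset.Icc 1 n, ∑ g : G.keys n, if fn x ≠ y ∧ PrefixEq G i g (fn x) y then
    2 ^ i * (hitProb G fn pa TA x y g i).toReal else 0

/-- Two separate uses of one sum: the terms where the sampled `x` is already a preimage, and the
terms where the collision finder succeeds. In the first, 1/2 is n prefix lengths times 1/(2n). -/
theorem inverter_outProb
  (hf : ∀ x : BitStr n, pf.HaltsWithin [List.ofFn x] TF)
  (hfo : ∀ x, pf.AlwaysOutputs [List.ofFn x] fun s => Holds s [List.ofFn (fn x)])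
  (hc : ∀ c : TwoPoint n, pc.HaltsWithin c.enc TC)
  (hout : ∀ (c : TwoPoint n) (g : G.keys n), G.Fits c g →
    pc.outProb c.enc (fun s => Holds s [g.1]) = 1 / (Nat.card {g' : G.keys n // G.Fits c g'} : ℝ))
  (hG3 : G.WiseIndependent 3) (hn : 2 ≤ n)
  (ha : ∀ (x : BitStr n) (g : G.keys n) (i : ℕ), 1 ≤ i → i ≤ n →
    pa.HaltsWithin [List.ofFn x, g.1, List.replicate i true] TA) (y : BitStr n) :
    (inverter pf pc pa).HaltsWithin [List.ofFn y] (TF + TC + TA + 300 * n + 100) ∧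
    (fiber fn y : ℝ) / (2 * 2 ^ n) ≤ (inverter pf pc pa).outProb [List.ofFn y]
      (fun s => ∃ x', fn x' = y ∧ Holds s [List.ofFn x']) ∧
    weightedHits G fn pa TA y / (2 ^ n * (2 * n) * Fintype.card (G.keys n)) ≤
      (inverter pf pc pa).outProb [List.ofFn y]
        (fun s => ∃ x', fn x' = y ∧ Holds s [List.ofFn x']) := by
  obtain ⟨μ, hμ, hle⟩ := inverter_wins hf hfo hc hout (card_fits hG3 hn) ha hn y
  have hn0 : (0 : ℝ) < n := by exact_mod_cast (by omega : 0 < n)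
  have hK : Nonempty (G.keys n) := (G.keys_nonempty n).to_subtype
  have hK0 : (0 : ℝ) < Fintype.card (G.keys n) := by exact_mod_cast Fintype.card_pos
  have hE : (inverter pf pc pa).outProb [List.ofFn y]
        (fun s => ∃ x', fn x' = y ∧ Holds s [List.ofFn x'])
      = (μ.toOuterMeasure {s | ∃ x', fn x' = y ∧ s 0 = List.ofFn x'}).toReal := by
    rw [hμ.outProb_eq]
    congr 2
    ext s
    simp [Holds]
  have hn1 : ((2 * n : ℕ) : ℝ≥0∞)⁻¹ ≠ ∞ := ENNReal.inv_ne_top.2 (by exact_mod_cast (by omega))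
  have hn2 : (2 ^ n : ℝ≥0∞)⁻¹ ≠ ∞ := ENNReal.inv_ne_top.2 (by simp)
  have hreal : ∑ x : BitStr n, (2 ^ n : ℝ)⁻¹ * ∑ i ∈ Finset.Icc 1 n,
      (2 * n : ℝ)⁻¹ * (hitValue G fn pa TA x y i).toReal
      ≤ (inverter pf pc pa).outProb [List.ofFn y]
        (fun s => ∃ x', fn x' = y ∧ Holds s [List.ofFn x']) := by
    rw [hE]
    refine le_trans (le_of_eq ?_) (ENNReal.toReal_mono (toOuterMeasure_ne_top _ _) hle)
    rw [ENNReal.toReal_sum]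
    · refine Finset.sum_congr rfl fun x _ => ?_
      rw [ENNReal.toReal_mul, ENNReal.toReal_sum, ← sum_range_succ_eq_Icc]
      · congr 1
        · simp
        · refine Finset.sum_congr rfl fun k _ => ?_
          rw [ENNReal.toReal_mul]
          simp
      · exact fun k _ => ENNReal.mul_ne_top hn1 (hitValue_ne_top x y _)
    · exact fun x _ => ENNReal.mul_ne_top hn2 (ENNReal.sum_ne_top.2 fun k _ =>
        ENNReal.mul_ne_top hn1 (hitValue_ne_top x y _))
  refine ⟨hμ.haltsWithin, le_trans ?_ hreal, le_trans ?_ hreal⟩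
  · have e : (fiber fn y : ℝ) / (2 * 2 ^ n) = ∑ x : BitStr n, (2 ^ n : ℝ)⁻¹ *
        ∑ i ∈ Finset.Icc 1 n, (2 * n : ℝ)⁻¹ * if fn x = y then 1 else 0 := by
      simp only [Finset.sum_const, Nat.card_Icc, nsmul_eq_mul]
      rw [← Finset.mul_sum, ← Finset.mul_sum, ← Finset.mul_sum, fiber, Finset.card_filter]
      push_cast
      field_simp
    rw [e]
    refine Finset.sum_le_sum fun x _ => mul_le_mul_of_nonneg_left (Finset.sum_le_sum fun i _ =>
      mul_le_mul_of_nonneg_left ?_ (by positivity)) (by positivity)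
    split_ifs with h
    · rw [toReal_hitValue, if_pos h]
    · exact ENNReal.toReal_nonneg
  · rw [weightedHits, Finset.sum_div]
    refine Finset.sum_le_sum fun x _ => ?_
    rw [Finset.mul_sum, Finset.sum_div]
    refine Finset.sum_le_sum fun i _ => ?_
    rw [toReal_hitValue]
    by_cases h : fn x = y
    · simp [h]
    · simp only [ne_eq, h, not_false_eq_true, true_and, if_false]
      rw [Finset.sum_div, Finset.mul_sum, Finset.mul_sum]
      refine Finset.sum_le_sum fun g _ => le_of_eq ?_
      split_ifs
      · field_simp
      · simp

end

/-! ### The collision finder rarely leaves the good set -/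

section
variable {f : ∀ n, BitStr n → BitStr n} {G : HashFamily} {A : Prog} {c n TA : ℕ}

theorem mem_goodSet {z z' : HashDom G n} : z' ∈ goodSet f G c n z ↔
    hashPrefix f G n z' = hashPrefix f G n z ∧ ¬ Bad f G c n z z' := by
  classical
  simp [goodSet]

/-- The output always lies in F⁻¹(F(z)), so leaving the good set means producing a preimage of a
heavy image y ≠ f(x) that collides with f(x). The claim is the union bound over y. -/
theorem one_sub_outProb_le (z : HashDom G n) (hhalt : A.HaltsWithin (HashDom.enc G n z) TA)
    (hcoll : A.AlwaysOutputs (HashDom.enc G n z) fun s =>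
      ∃ z', hashPrefix f G n z' = hashPrefix f G n z ∧ Holds s (HashDom.enc G n z')) :
    1 - A.outProb (HashDom.enc G n z) (fun s => ∃ z' ∈ goodSet f G c n z,
        Holds s (HashDom.enc G n z'))
      ≤ ∑ y, if (f n z.1 ≠ y ∧ PrefixEq G z.2.2 z.2.1 (f n z.1) y) ∧
          Heavy n c z.2.2 (fiber (f n) y) then
        (hitProb G (f n) A TA z.1 y z.2.1 z.2.2).toReal else 0 := by
  rw [hhalt.outProb_eq]
  set μ := A.run (HashDom.enc G n z) TA with hμ
  set L : Set Config := {k | ∃ z' ∈ goodSet f G c n z, Holds k.2 (HashDom.enc G n z')} with hL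
  set Y := Finset.univ.filter fun y => (f n z.1 ≠ y ∧ PrefixEq G z.2.2 z.2.1 (f n z.1) y) ∧
          Heavy n c z.2.2 (fiber (f n) y) with hY
  let E : BitStr n → Set Config := fun y => {k | ∃ x', f n x' = y ∧ k.2 0 = List.ofFn x'}
  have hsupp : μ.support ⊆ L ∪ ⋃ y ∈ Y, E y := by
    intro k hk
    obtain ⟨z', hz', hh⟩ := hcoll TA k hk (hhalt k hk)
    by_cases hb : Bad f G c n z z'
    · right
      have hp := (hashPrefix_eq_iff z z').1 hz'
      have h0 : k.2 0 = List.ofFn z'.1 := hh 0 (by simp [HashDom.enc])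
      have hbad : Heavy n c z.2.2 (fiber (f n) (f n z'.1)) := by
        have := hb.2; rwa [hp.1] at this
      exact Set.mem_biUnion (x := f n z'.1)
        (Finset.mem_coe.2 (Finset.mem_filter.2 ⟨Finset.mem_univ _, ⟨hb.1, hp.2⟩, hbad⟩))
        ⟨z'.1, rfl, h0⟩
    · left
      exact ⟨z', mem_goodSet.2 ⟨hz', hb⟩, hh⟩
  have hone := (PMF.toOuterMeasure_apply_eq_one_iff μ _).2 hsupp
  have h1 : (1 : ℝ≥0∞) ≤ μ.toOuterMeasure L + ∑ y ∈ Y, μ.toOuterMeasure (E y) := by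
    rw [← hone]
    exact (MeasureTheory.measure_union_le _ _).trans
      (add_le_add_right (MeasureTheory.measure_biUnion_finset_le Y E) _)
  have hsum : ∑ y ∈ Y, μ.toOuterMeasure (E y) ≠ ∞ :=
    ENNReal.sum_ne_top.2 fun y _ => toOuterMeasure_ne_top _ _
  have h2 := ENNReal.toReal_mono (ENNReal.add_ne_top.2 ⟨toOuterMeasure_ne_top _ _, hsum⟩) h1
  rw [ENNReal.toReal_one, ENNReal.toReal_add (toOuterMeasure_ne_top _ _) hsum,
    ENNReal.toReal_sum fun y _ => toOuterMeasure_ne_top _ _] at h2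
  rw [← Finset.sum_filter, ← hY]
  have h3 : ∀ y, (hitProb G (f n) A TA z.1 y z.2.1 z.2.2).toReal
      = (μ.toOuterMeasure (E y)).toReal := fun y => rfl
  simp_rw [h3]
  linarith

/-- A change of measure: the fiber size over 2^n turns the sum over y into y = f(X), and 2^i is the
density of the inverter's sample. Heaviness says exactly that these factors times n^c are at least
1. -/
theorem expect_one_sub_outProb_le (hn : 2 ≤ n)
    (hhalt : ∀ z, A.HaltsWithin (HashDom.enc G n z) TA)
    (hcoll : ∀ z, A.AlwaysOutputs (HashDom.enc G n z) fun s =>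
      ∃ z', hashPrefix f G n z' = hashPrefix f G n z ∧ Holds s (HashDom.enc G n z')) :
    𝔼 z, (1 - A.outProb (HashDom.enc G n z) (fun s => ∃ z' ∈ goodSet f G c n z,
        Holds s (HashDom.enc G n z')))
      ≤ 2 * n ^ c * 𝔼 x, weightedHits G (f n) A TA (f n x) /
          (2 ^ n * (2 * n) * Fintype.card (G.keys n)) := by
  have hn0 : (0 : ℝ) < n := by exact_mod_cast (by omega : 0 < n)
  have hK : Nonempty (G.keys n) := (G.keys_nonempty n).to_subtype
  have hK0 : (0 : ℝ) < Fintype.card (G.keys n) := by exact_mod_cast Fintype.card_pos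
  have hcardD : (Fintype.card (HashDom G n) : ℝ) = 2 ^ n * (Fintype.card (G.keys n) * n) := by
    rw [Fintype.card_prod, Fintype.card_prod, card_bitStr, Fintype.card_coe (Finset.Icc 1 n),
      Nat.card_Icc]
    push_cast
    simp
  set T : BitStr n → BitStr n → G.keys n → ℕ → ℝ := fun y x g i =>
    if f n x ≠ y ∧ PrefixEq G i g (f n x) y then
      2 ^ i * (hitProb G (f n) A TA x y g i).toReal else 0 with hT
  have hpt : ∀ z : HashDom G n, 1 - A.outProb (HashDom.enc G n z)
      (fun s => ∃ z' ∈ goodSet f G c n z, Holds s (HashDom.enc G n z'))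
      ≤ n ^ c / 2 ^ n * ∑ y, (fiber (f n) y : ℝ) * T y z.1 z.2.1 z.2.2 := by
    intro z
    refine (one_sub_outProb_le z (hhalt z) (hcoll z)).trans ?_
    rw [Finset.mul_sum]
    refine Finset.sum_le_sum fun y _ => ?_
    have h0 : 0 ≤ (hitProb G (f n) A TA z.1 y z.2.1 z.2.2).toReal := ENNReal.toReal_nonneg
    by_cases h1 : f n z.1 ≠ y ∧ PrefixEq G z.2.2 z.2.1 (f n z.1) y
    · simp only [hT, if_pos h1]
      by_cases h2 : Heavy n c z.2.2 (fiber (f n) y)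
      · rw [if_pos ⟨h1, h2⟩]
        have h3 : (2 ^ n : ℝ) ≤ fiber (f n) y * 2 ^ (z.2.2 : ℕ) * n ^ c := by exact_mod_cast h2
        have h4 : 1 ≤ (n : ℝ) ^ c / 2 ^ n * (fiber (f n) y * 2 ^ (z.2.2 : ℕ)) := by
          rw [div_mul_eq_mul_div, le_div_iff₀ (by positivity)]
          linarith
        calc (hitProb G (f n) A TA z.1 y z.2.1 z.2.2).toReal
            ≤ ((n : ℝ) ^ c / 2 ^ n * (fiber (f n) y * 2 ^ (z.2.2 : ℕ))) *
              (hitProb G (f n) A TA z.1 y z.2.1 z.2.2).toReal := le_mul_of_one_le_left h0 h4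
          _ = _ := by ring
      · rw [if_neg fun h => h2 h.2]
        positivity
    · rw [if_neg fun h => h1 h.1]
      simp [hT, h1]
  have hsum : ∑ z : HashDom G n, n ^ c / 2 ^ n * ∑ y, (fiber (f n) y : ℝ) * T y z.1 z.2.1 z.2.2
      = n ^ c / 2 ^ n * ∑ x, weightedHits G (f n) A TA (f n x) := by
    rw [← Finset.mul_sum, Finset.sum_comm, ← sum_fiber_mul]
    congr 1
    refine Finset.sum_congr rfl fun y _ => ?_
    rw [← Finset.mul_sum]
    congr 1
    rw [Fintype.sum_prod_type]
    refine Finset.sum_congr rfl fun x _ => ?_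
    rw [Fintype.sum_prod_type, Finset.sum_comm]
    exact Finset.sum_coe_sort (Finset.Icc 1 n) fun i => ∑ g : G.keys n, T y x g i
  rw [Fintype.expect_eq_sum_div_card, Fintype.expect_eq_sum_div_card, hcardD, card_bitStr,
    ← Finset.sum_div, div_le_iff₀ (by positivity)]
  refine (Finset.sum_le_sum fun z _ => hpt z).trans (le_of_eq ?_)
  rw [hsum]
  push_cast
  field_simp

end

/-! ### Rarity of large fibers, choice of the exponent, negligible error -/

theorem card_heavy_le {n c : ℕ} (fn : BitStr n → BitStr n) {ν : ℝ}
    (hν : 𝔼 x, (fiber fn (fn x) : ℝ) / (2 * 2 ^ n) ≤ ν) (h : 2 * n ^ c * ν ≤ 1 / 4) :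
    4 * (Finset.univ.filter fun x => ¬ fiber fn (fn x) * n ^ c ≤ 2 ^ n).card ≤ 2 ^ n := by
  set B := Finset.univ.filter fun x => ¬ fiber fn (fn x) * n ^ c ≤ 2 ^ n with hB
  -- Markov's inequality: a random guess inverts f(x) with probability fiber/2^n, whose average is
  -- at most 2ν.
  have h1 : (B.card : ℝ) * 2 ^ n ≤ ∑ x, (fiber fn (fn x) : ℝ) * n ^ c := by
    rw [← nsmul_eq_mul]
    refine (Finset.card_nsmul_le_sum B _ _ fun x hx => ?_).trans
      (Finset.sum_le_sum_of_subset_of_nonneg (Finset.subset_univ _) fun x _ _ => by positivity)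
    have := (Finset.mem_filter.1 hx).2
    push Not at this
    exact_mod_cast this.le
  rw [Fintype.expect_eq_sum_div_card, card_bitStr, ← Finset.sum_div] at hν
  rw [← Finset.sum_mul] at h1
  push_cast at hν
  set S := ∑ x, (fiber fn (fn x) : ℝ) with hS
  have h2 : (0 : ℝ) < 2 ^ n := by positivity
  rw [div_div, div_le_iff₀ (by positivity)] at hν
  have h3 : (0 : ℝ) ≤ (n : ℝ) ^ c := by positivity
  have h4 : (B.card : ℝ) * 2 ^ n ≤ (2 * n ^ c * ν) * (2 ^ n * 2 ^ n) := by nlinarith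
  have h5 : (B.card : ℝ) * 2 ^ n ≤ 1 / 4 * 2 ^ n * 2 ^ n :=
    h4.trans (by nlinarith [mul_pos h2 h2])
  have h6 : (B.card : ℝ) ≤ 1 / 4 * 2 ^ n := le_of_mul_le_mul_right h5 h2
  have h7 : (4 * B.card : ℝ) ≤ 2 ^ n := by linarith
  exact_mod_cast h7

/-- The 8 cancels the denominator. The 7 is the 6 lost in the window plus 1 for rounding the
logarithm, absorbed because log n ≥ 1. -/
theorem le_log_sub_div {c n : ℕ} {d : ℝ} (hc : 8 * d + 7 ≤ c) (hn : 2 ≤ n) :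
    d * Real.logb 2 n / n ≤ ((Nat.log 2 (n ^ c) - 6 : ℕ) : ℝ) / (8 * n) := by
  have hn0 : (0 : ℝ) < n := by exact_mod_cast (by omega : 0 < n)
  have h1 : (1 : ℝ) ≤ Real.logb 2 n := by
    rw [Real.le_logb_iff_rpow_le (by norm_num) hn0, Real.rpow_one]
    exact_mod_cast hn
  have h2 : c * Real.logb 2 n ≤ Nat.log 2 (n ^ c) + 1 := by
    have h := Nat.lt_pow_succ_log_self (b := 2) (by norm_num) (n ^ c)
    have h' : ((n : ℝ) ^ c) ≤ 2 ^ (Nat.log 2 (n ^ c) + 1) := by exact_mod_cast h.le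
    have h'' := Real.logb_le_logb_of_le (b := 2) (by norm_num) (by positivity) h'
    rw [Real.logb_pow, Real.logb_pow, Real.logb_self_eq_one (by norm_num)] at h''
    push_cast at h''
    linarith
  have h3 : ((Nat.log 2 (n ^ c) : ℕ) : ℝ) - 6 ≤ ((Nat.log 2 (n ^ c) - 6 : ℕ) : ℝ) := by
    have : Nat.log 2 (n ^ c) ≤ (Nat.log 2 (n ^ c) - 6) + 6 := by omega
    have : ((Nat.log 2 (n ^ c) : ℕ) : ℝ) ≤ ((Nat.log 2 (n ^ c) - 6 : ℕ) : ℝ) + 6 := by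
      exact_mod_cast this
    linarith
  have h4 : (8 * d + 7) * Real.logb 2 n ≤ c * Real.logb 2 n :=
    mul_le_mul_of_nonneg_right hc (by linarith)
  rw [div_le_div_iff₀ hn0 (by positivity)]
  have h5 : 8 * (d * Real.logb 2 n) ≤ ((Nat.log 2 (n ^ c) - 6 : ℕ) : ℝ) := by nlinarith
  nlinarith

/-- The cap at 1 keeps the values in [0, 1]; superpolynomial decay absorbs the factor n^c. -/
theorem negligible_min {ν : ℕ → ℝ} (hν : Negligible ν) (c : ℕ) :
    Negligible fun n => min 1 (2 * n ^ c * ν n) := by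
  have h0 : ∀ n : ℕ, 0 ≤ 2 * (n : ℝ) ^ c * ν n := fun n => mul_nonneg (by positivity) (hν.1 n).1
  refine ⟨fun n => ⟨le_min zero_le_one (h0 n), min_le_left _ _⟩, ?_⟩
  refine ((hν.2.param_pow_mul c).const_mul 2).trans_abs_le fun n => ?_
  rw [abs_of_nonneg (le_min zero_le_one (h0 n))]
  refine (min_le_right _ _).trans (le_of_eq_of_le ?_ (le_abs_self _))
  simp [mul_assoc]

theorem eventually_le_quarter {ν : ℕ → ℝ} (hν : Negligible ν) (c : ℕ) :
    ∀ᶠ n : ℕ in atTop, 2 * n ^ c * ν n ≤ 1 / 4 := by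
  have h := ((hν.2.param_pow_mul c).const_mul 2) 0
  filter_upwards [h.eventually (gt_mem_nhds (show (0 : ℝ) < 1 / 4 by norm_num))] with n hn
  simp at hn
  rw [mul_assoc]
  linarith

theorem outProb_nonneg (p : Prog) (xs : List (List Bool)) (E : Store → Prop) :
    0 ≤ p.outProb xs E := ENNReal.toReal_nonneg

end InaccessibleEntropy

end

theorem mainTheorem2 (f : ∀ n, InaccessibleEntropy.BitStr n → InaccessibleEntropy.BitStr n)
    (hf : InaccessibleEntropy.IsOneWay f)
    (G : InaccessibleEntropy.HashFamily) (hG : G.Constructible) (hG3 : G.WiseIndependent 3)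
    (d : ℝ) (hd : 0 < d) :
    InaccessibleEntropy.AccAvgMaxEntropyAtMost
      (InaccessibleEntropy.hashPrefix f G) (InaccessibleEntropy.HashDom.enc G)
      (fun n => InaccessibleEntropy.condEntropy
          (fun z : InaccessibleEntropy.HashDom G n => z) (InaccessibleEntropy.hashPrefix f G n)
        - d * Real.logb 2 n / n) := by
  open InaccessibleEntropy in
  intro A hA hcoll
  obtain ⟨pf, -, ⟨qf, hqf⟩, hfo⟩ := hf.computable
  obtain ⟨-, pc, ⟨qc, hqc⟩, hout⟩ := hG
  obtain ⟨qa, hqa⟩ := hA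
  obtain ⟨c, hc⟩ := exists_nat_ge (8 * d + 7)
  have ha : ∀ n (x : BitStr n) (g : G.keys n) (i : ℕ), 1 ≤ i → i ≤ n →
      A.HaltsWithin [List.ofFn x, g.1, List.replicate i true] (qa.eval n) :=
    fun n x g i h1 h2 => hqa n (x, g, ⟨i, Finset.mem_Icc.2 ⟨h1, h2⟩⟩)
  have hinv := fun n (hn : 2 ≤ n) (y : BitStr n) => inverter_outProb (hqf n) (hfo n) (hqc n)
    (hout n) hG3 hn (ha n) y
  -- The inverter does not depend on `c`, so a single inversion probability serves both the entropy
  -- gap and the escape bound.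
  have hpoly : (inverter pf pc A).PolyTimeOn (fun n (y : BitStr n) => [List.ofFn y]) := by
    refine ⟨qf + qc + qa + Polynomial.C 300 * Polynomial.X + Polynomial.C 100, fun n y => ?_⟩
    simp only [Polynomial.eval_add, Polynomial.eval_mul, Polynomial.eval_C, Polynomial.eval_X]
    by_cases hn : 2 ≤ n
    · exact (hinv n hn y).1
    · obtain ⟨μ, hμ⟩ := inverter_runs_of_le_one (by omega : n ≤ 1) pf pc A y
      exact (hμ.mono (by omega)).haltsWithin
  have hneg := hf.hard _ hpoly
  set ν : ℕ → ℝ := fun n => 𝔼 x : BitStr n, (inverter pf pc A).outProb [List.ofFn (f n x)]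
      (fun s => ∃ x' : BitStr n, f n x' = f n x ∧ Holds s [List.ofFn x']) with hν
  refine ⟨fun n z => goodSet f G c n z, _, negligible_min hneg c, fun n z => ?_, ?_⟩
  · exact mem_goodSet.2 ⟨rfl, fun h => h.1 rfl⟩
  filter_upwards [eventually_ge_atTop 2, eventually_le_quarter hneg c] with n hn hq
  have hK : Nonempty (G.keys n) := (G.keys_nonempty n).to_subtype
  have hI : Nonempty (Finset.Icc 1 n) := ⟨⟨1, Finset.mem_Icc.2 ⟨le_rfl, by omega⟩⟩⟩
  constructor
  · refine (entropy_gap hG3 hn (card_heavy_le (f n) (ν := ν n) ?_ hq)).trans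
      (sub_le_sub_left (le_log_sub_div hc hn) _)
    exact Finset.expect_le_expect fun x _ => (hinv n hn (f n x)).2.1
  · have h1 := expect_one_sub_outProb_le (f := f) (c := c) hn (hqa n) (hcoll n)
    have h2 : 𝔼 x, weightedHits G (f n) A (qa.eval n) (f n x) /
          (2 ^ n * (2 * n) * Fintype.card (G.keys n)) ≤ ν n :=
      Finset.expect_le_expect fun x _ => (hinv n hn (f n x)).2.2
    have h3 : (0 : ℝ) ≤ 2 * (n : ℝ) ^ c := by positivity
    rw [Finset.expect_sub_distrib, Finset.expect_const Finset.univ_nonempty] at h1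
    have h4 := h1.trans (mul_le_mul_of_nonneg_left h2 h3)
    have h5 : 0 ≤ 𝔼 z : HashDom G n, A.outProb (HashDom.enc G n z)
        (fun s => ∃ z' ∈ goodSet f G c n z, Holds s (HashDom.enc G n z')) :=
      Finset.expect_nonneg fun z _ => outProb_nonneg _ _ _
    -- If the error is capped at 1, the bound only says that a probability is nonnegative.
    rcases min_choice 1 (2 * (n : ℝ) ^ c * ν n) with h | h <;> rw [h] <;> linarith
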